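/- Let $\mathcal{N}=\mathbb{N}^{\mathbb{N}}$ be the Baire space. A *represented space* is a set $X$ with a partial surjection $\delta_X:\subseteq\mathcal{N}\to X$; a *name* of $x$ is any $p$ with $\delta_X(p)=x$, and $x$ is *computable* if it has a computable name. Its topology is the final topology of $\delta_X$. A function $f:X\to Y$ between represented spaces is *continuous* (resp. *computable*, *computable with oracle $A$*) if some continuous (resp. computable, computable with oracle $A$) $F:\operatorname{dom}(\delta_X)\to\operatorname{dom}(\delta_Y)$ satisfies $\delta_Y(F(p))=f(\delta_X(p))$ for all $p\in\operatorname{dom}(\delta_X)$; such an $F$ is a *realizer* of $f$. Subsets carry the restricted representation. $\mathcal{C}(X,Y)$ is the represented space of continuous functions $X\to Y$, a name of $f$ being an enumeration of a list of pairs $(u,v)$ of finite sequences which describes a continuous realizer $F$ of $f$: for each $p\in\operatorname{dom}(\delta_X)$, if $(u,v)$ is listed and $u$ is a prefix of $p$ then $v$ is a prefix of $F(p)$, and every prefix $v$ of $F(p)$ occurs in a listed pair $(u,v)$ with $u$ a prefix of $p$. The spaces $\mathcal{N}$, $\mathbb{N}$ and $2=\{0,1\}$ are represented by the identity, $p\mapsto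 p(0)$ and $p\mapsto p(0)$ (for $p(0)<2$) respectively. The space of open subsets of $X$ is $\mathcal{O}(X)=\mathcal{C}(X,\mathbb{S})$, where in the Sierpiński space $\mathbb{S}=\{\bot,\top\}$ the zero sequence names $\bot$ and every other sequence names $\top$. $X$ is *$\mathcal{N}$-based* if there is a continuous function $\mathcal{N}\to\mathcal{O}(X)$ whose image is a basis of the topology of $X$. The classes $\Sigma^1_1$ and $\Delta^1_1$ are the lightface classes of subsets of $\mathbb{N}$. **Theorem.** Let $X=\mathcal{C}(\mathcal{N},2)$ be the space of clopen subsets of the Baire space. 1. $X$ is not $\mathcal{N}$-based, and $\mathcal{O}(X)$ is not a continuous image of $\mathcal{N}$: there is no continuous surjection $\mathcal{N}\to\mathcal{O}(X)$. 2. The computable open subsets of $X$ are not $\Sigma^1_1$-enumerable: for no $\Sigma^1_1$ set $A\subseteq\mathbb{N}$ is there a computable surjection from $A$ onto the subspace of computable points of $\mathcal{O}(X)$. 3. The computable open subsets of $X$ are not enumerable relative to any $\Delta^1_1$ oracle: for no $\Delta^1_1$ set $A\subseteq\mathbb{N}$ is there a function $\phi:\mathbb{N}\to\mathcal{O}(X)$,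 computable with oracle $A$, whose range contains all computable points of $\mathcal{O}(X)$. -/

import Mathlib

/-- The Baire space of sequences of natural numbers. As a topological space it carries Mathlib's
product topology (with `ℕ` discrete). -/
abbrev Baire : Type := ℕ → ℕ

/-- The finite sequence `u` is a prefix of the infinite sequence `p`. -/
def IsPrefix (u : List ℕ) (p : Baire) : Prop :=
  ∀ (i : ℕ) (hi : i < u.length), u[i] = p i

/-- The pair `(u, v)` of finite sequences appears in the list of pairs encoded by `q`. -/
def ListsPair (q : Baire) (u v : List ℕ) : Prop :=
  ∃ n, q n = Encodable.encode (u, v)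

/-- The list of pairs encoded by `q` describes the function `F` on the set `D`: if `u` is a prefix
of `p ∈ D` and `(u, v)` is listed then `F p` extends `v`, and for every prefix `v` of `F p` there
is a prefix `u` of `p` such that `(u, v)` is listed. -/
def Codes (q : Baire) (D : Set Baire) (F : Baire → Baire) : Prop :=
  ∀ p ∈ D,
    (∀ u v, ListsPair q u v → IsPrefix u p → IsPrefix v (F p)) ∧
    (∀ v, IsPrefix v (F p) → ∃ u, IsPrefix u p ∧ ListsPair q u v)

/-- The characteristic function of a set of natural numbers. -/
noncomputable def charFun (A : Set ℕ) : ℕ → ℕ := A.indicator 1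

/-- The partial function `F` with domain `D` is computable: it is described by a computable list of
pairs of finite sequences. (Values of `F` outside `D` are irrelevant.) -/
def ComputableOn (F : Baire → Baire) (D : Set Baire) : Prop :=
  ∃ q : Baire, Computable q ∧ Codes q D F

/-- The partial function `F` with domain `D` is computable with oracle `A`. -/
def ComputableOnRel (A : Set ℕ) (F : Baire → Baire) (D : Set Baire) : Prop :=
  ∃ q : Baire, ComputableIn {(charFun A : ℕ →. ℕ)} q ∧ Codes q D F

/-- A represented space: a set together with a partial surjection from the Baire space, given by
its graph: `Names p x` means that the partial surjection is defined at `p`, with value `x`. -/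
structure RepresentedSpace where
  /-- The underlying set. -/
  carrier : Type
  /-- `p` is a name of `x`. -/
  Names : Baire → carrier → Prop
  unique : ∀ p x y, Names p x → Names p y → x = y
  surj : ∀ x, ∃ p, Names p x

namespace RepresentedSpace

/-- The domain of the representation. -/
def dom (X : RepresentedSpace) : Set Baire := {p | ∃ x, X.Names p x}

/-- The representation as a function on its domain. -/
noncomputable def rep (X : RepresentedSpace) (p : X.dom) : X.carrier := p.2.choose

/-- The canonical topology: the final topology of the representation, whose domain carries the
subspace topology. -/
@[reducible] noncomputable def topology (X : RepresentedSpace) : TopologicalSpace X.carrier :=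
  TopologicalSpace.coinduced X.rep inferInstance

/-- `F` is a realizer of `f`: it maps every name of every `x` to a name of `f x`. -/
def Realizes (X Y : RepresentedSpace) (F : Baire → Baire) (f : X.carrier → Y.carrier) : Prop :=
  ∀ p x, X.Names p x → Y.Names (F p) (f x)

/-- `f` has a continuous realizer. -/
def IsContinuous (X Y : RepresentedSpace) (f : X.carrier → Y.carrier) : Prop :=
  ∃ F : Baire → Baire, ContinuousOn F X.dom ∧ Realizes X Y F f

/-- `f` has a computable realizer. -/
def IsComputable (X Y : RepresentedSpace) (f : X.carrier → Y.carrier) : Prop :=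
  ∃ F : Baire → Baire, ComputableOn F X.dom ∧ Realizes X Y F f

/-- `f` has a realizer that is computable with oracle `A`. -/
def IsComputableRel (A : Set ℕ) (X Y : RepresentedSpace) (f : X.carrier → Y.carrier) : Prop :=
  ∃ F : Baire → Baire, ComputableOnRel A F X.dom ∧ Realizes X Y F f

/-- `Y` is a continuous image of `X`. -/
def IsContinuousImage (X Y : RepresentedSpace) : Prop :=
  ∃ f : X.carrier → Y.carrier, IsContinuous X Y f ∧ Function.Surjective f

/-- `Y` is a computable image of `X`. -/
def IsComputableImage (X Y : RepresentedSpace) : Prop :=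
  ∃ f : X.carrier → Y.carrier, IsComputable X Y f ∧ Function.Surjective f

/-- The subset `S` of `X`, with the restricted representation. -/
def sub (X : RepresentedSpace) (S : Set X.carrier) : RepresentedSpace where
  carrier := S
  Names p x := X.Names p x
  unique p x y hx hy := Subtype.ext (X.unique p x y hx hy)
  surj x := X.surj x

/-- The points that have a computable name. -/
def computablePoints (X : RepresentedSpace) : Set X.carrier :=
  {x | ∃ p, Computable p ∧ X.Names p x}

/-- The Baire space, represented by the identity. -/
def baire : RepresentedSpace where
  carrier := Baire
  Names p x := p = x
  unique _ _ _ hx hy := hx.symm.trans hy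
  surj x := ⟨x, rfl⟩

/-- The natural numbers: a name of `n` is a sequence with first term `n`. -/
def nat : RepresentedSpace where
  carrier := ℕ
  Names p n := p 0 = n
  unique _ _ _ hx hy := hx.symm.trans hy
  surj n := ⟨fun _ => n, rfl⟩

/-- The two-point space `{0, 1}`: a name of `i` is a sequence with first term `i`. -/
def two : RepresentedSpace where
  carrier := Fin 2
  Names p i := p 0 = i
  unique _ _ _ hx hy := Fin.ext (hx.symm.trans hy)
  surj i := ⟨fun _ => i, rfl⟩

/-- The Sierpiński space, with `⊥` as `False` and `⊤` as `True`: the zero sequence is the only name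
of `⊥`, every other sequence is a name of `⊤`. -/
def sierpinski : RepresentedSpace where
  carrier := Prop
  Names p b := (p ≠ fun _ => 0) ↔ b
  unique _ _ _ hx hy := propext (hx.symm.trans hy)
  surj b := by
    by_cases hb : b
    · exact ⟨fun _ => 1, by simp [hb, funext_iff]⟩
    · exact ⟨fun _ => 0, by simp [hb]⟩

end RepresentedSpace

/-- The prefix of `p` of length `k`. -/
def prefixOf (p : Baire) (k : ℕ) : List ℕ := List.ofFn fun i : Fin k => p i

theorem isPrefix_prefixOf (p : Baire) (k : ℕ) : IsPrefix (prefixOf p k) p := by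
  intro i hi
  simp [prefixOf]

theorem isPrefix_iff_eq_prefixOf {u : List ℕ} {p : Baire} :
    IsPrefix u p ↔ u = prefixOf p u.length := by
  refine ⟨fun h => ?_, fun h => h ▸ isPrefix_prefixOf p _⟩
  refine List.ext_getElem (by simp [prefixOf]) fun i h1 _ => ?_
  simpa [prefixOf] using h i h1

theorem Codes.eq {q : Baire} {D : Set Baire} {F G : Baire → Baire} (hF : Codes q D F)
    (hG : Codes q D G) {p : Baire} (hp : p ∈ D) : F p = G p := by
  funext n
  obtain ⟨u, hu, hl⟩ := (hF p hp).2 _ (isPrefix_prefixOf (F p) (n + 1))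
  have h := (hG p hp).1 _ _ hl hu n (by simp [prefixOf])
  simpa [prefixOf, -List.ofFn_succ] using h

theorem exists_codes {D : Set Baire} {F : Baire → Baire} (hF : ContinuousOn F D) :
    ∃ q, Codes q D F := by
  let S : Set ℕ := {n | ∃ u v, n = Encodable.encode ((u, v) : List ℕ × List ℕ) ∧
    ∀ p ∈ D, IsPrefix u p → IsPrefix v (F p)}
  have hS : S.Nonempty :=
    ⟨_, [], [], rfl, fun p _ _ i hi => absurd hi (Nat.not_lt_zero i)⟩
  obtain ⟨q, hq⟩ := S.to_countable.exists_eq_range hS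
  have hl : ∀ u v, ListsPair q u v ↔ ∀ p ∈ D, IsPrefix u p → IsPrefix v (F p) := by
    intro u v
    have h1 : ListsPair q u v ↔ Encodable.encode (u, v) ∈ S := by rw [hq]; rfl
    rw [h1]
    constructor
    · rintro ⟨u', v', h, h'⟩
      obtain ⟨rfl, rfl⟩ := Prod.mk.inj (Encodable.encode_injective h)
      exact h'
    · exact fun h => ⟨u, v, rfl, h⟩
  refine ⟨q, fun p hp => ⟨fun u v h hu => (hl u v).1 h p hp hu, fun v hv => ?_⟩⟩
  have hopen : {x : Baire | IsPrefix v x} ∈ nhds (F p) := by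
    refine IsOpen.mem_nhds ?_ hv
    have h2 : {x : Baire | IsPrefix v x} =
        ⋂ i : Fin v.length, (fun x : Baire => x i) ⁻¹' {v[i]} := by
      ext x
      simp only [IsPrefix, Set.mem_ofPred_eq, Set.mem_iInter, Set.mem_preimage,
        Set.mem_singleton_iff]
      exact ⟨fun h i => (h i i.2).symm, fun h i hi => (h ⟨i, hi⟩).symm⟩
    rw [h2]
    exact isOpen_iInter_of_finite fun i => (isOpen_discrete _).preimage (continuous_apply _)
  have hpre := mem_nhdsWithin_iff_exists_mem_nhds_inter.1 ((hF p hp) hopen)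
  obtain ⟨W, hW, hWD⟩ := hpre
  rw [nhds_pi, Filter.mem_pi] at hW
  obtain ⟨I, hI, t, ht, hIt⟩ := hW
  obtain ⟨N, hN⟩ := hI.bddAbove
  refine ⟨prefixOf p (N + 1), isPrefix_prefixOf p _, (hl _ _).2 fun p' hp' hpp' => ?_⟩
  refine hWD ⟨hIt fun i hi => ?_, hp'⟩
  have h3 := hpp' i (by simpa [prefixOf] using Nat.lt_succ_of_le (hN hi))
  have h4 : p i = p' i := by simpa [prefixOf, -List.ofFn_succ] using h3
  exact h4 ▸ mem_of_mem_nhds (ht i)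

namespace RepresentedSpace

/-- The space `C(X, Y)` of functions with a continuous realizer. A name of `f` is a list of pairs
of finite sequences describing some continuous realizer of `f` on the domain of the representation
of `X`. -/
def cont (X Y : RepresentedSpace) : RepresentedSpace where
  carrier := {f : X.carrier → Y.carrier // IsContinuous X Y f}
  Names q f := ∃ F : Baire → Baire, ContinuousOn F X.dom ∧ Realizes X Y F f.1 ∧ Codes q X.dom F
  unique := by
    rintro q f g ⟨F, -, hF, hqF⟩ ⟨G, -, hG, hqG⟩
    refine Subtype.ext (funext fun x => ?_)
    obtain ⟨p, hp⟩ := X.surj x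
    have h := Codes.eq hqF hqG ⟨x, hp⟩
    exact Y.unique _ _ _ (hF p x hp) (h ▸ hG p x hp)
  surj := by
    rintro ⟨f, F, hc, hF⟩
    obtain ⟨q, hq⟩ := exists_codes hc
    exact ⟨q, F, hc, hF, hq⟩

/-- The space `O(X) = C(X, 𝕊)` of open subsets of `X`. -/
def opens (X : RepresentedSpace) : RepresentedSpace := cont X sierpinski

/-- The subset of `X` with characteristic function `U`. -/
def toSet {X : RepresentedSpace} (U : X.opens.carrier) : Set X.carrier := {x | U.1 x}

/-- `X` is `𝒩`-based: some continuous function from the Baire space to `O(X)` has a basis of the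
topology of `X` as its image. -/
def IsBaireBased (X : RepresentedSpace) : Prop :=
  ∃ f : baire.carrier → X.opens.carrier, IsContinuous baire X.opens f ∧
    @TopologicalSpace.IsTopologicalBasis X.carrier X.topology (Set.range fun p => toSet (f p))

/-- The set of computable points of `X` is a computable image of a set of natural numbers
in the class `Γ`. -/
def ComputablePointsEnumerable (Γ : Set (Set ℕ)) (X : RepresentedSpace) : Prop :=
  ∃ A ∈ Γ, IsComputableImage (nat.sub A) (X.sub X.computablePoints)

/-- Some sequence of points of `X` that is computable with oracle `A` contains all the computable
points of `X`. -/
def ComputablePointsEnumerableRel (A : Set ℕ) (X : RepresentedSpace) : Prop :=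
  ∃ f : nat.carrier → X.carrier, IsComputableRel A nat X f ∧ X.computablePoints ⊆ Set.range f

/-- The space `C(𝒩, 2)` of clopen subsets of the Baire space. -/
def clopens : RepresentedSpace := cont baire two

end RepresentedSpace

/-- The (lightface) `Σ¹₁` sets of natural numbers: those defined by `∃ f ∈ 𝒩, ∀ k, R n (f ↾ k)`
with a decidable relation `R`. -/
def sigma11 : Set (Set ℕ) :=
  {A | ∃ R : ℕ × List ℕ → Prop, ComputablePred R ∧
    ∀ n, n ∈ A ↔ ∃ f : Baire, ∀ k, R (n, prefixOf f k)}

/-- The (lightface) `Δ¹₁` sets of natural numbers. -/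
def delta11 : Set (Set ℕ) := {A | A ∈ sigma11 ∧ Aᶜ ∈ sigma11}

/-!
The proof constructs an open set that escapes any given family of open sets by means of one
self-referential tree.

Let `X` be the space of clopen subsets of the Baire space. To a set `T` of finite sequences
without infinite path (below, a *tree*) a set `treeSet T` of clopen sets is attached that
contains the empty set. Membership of `f` is recognized by a search: `f` must vanish at the zero
sequence, hence on the basic open set of `0 ^ j` for some `j`, which settles all but finitely
many indices `k`. For each remaining `k` the search starts at the root of `T`. At a node `s` it
requires `f` to vanish at a test point of `s`; then, if `f` vanishes at a limit point of `s`,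
only finitely many edges from `s` can be marked by `f`, and the search goes on at the children
at the ends of the marked edges. The search terminates because `T` has no infinite path, so
`treeSet T` is open (`exists_open_treeSet`), and it is a computable open set if `T` is
computable. The clopen set that marks the edges from the root to a node `s` and contains the
test point of `s` is not in `treeSet T` if `s` and its prefixes are in `T`
(`not_treeSet_of_marks`). On the other hand, if `α` is an infinite sequence then every open
neighbourhood of the empty set contains one of these clopen sets for a prefix of `α`, by a
twofold limit (`exists_marks_mem`). Hence if `V` is an open neighbourhood of the empty set that
contains none of the clopen sets given by nodes of `T` then `T` has no infinite path, and if `V`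
contains one of them then `V` is not included in `treeSet T`.

Now let a family of names `F p` of open sets be given, where `p` ranges over a `Σ¹₁` condition
and `F` is described by a list of pairs with `Σ¹₁` graph. The tree `diagonalTree` consists of
the finite approximations to sequences that encode a member `x = F p` of the family, witnesses
for `p` and `x`, and a witness that the empty set belongs to the open set `V` named by `x`; an
approximation is removed as soon as `V` is seen to contain a clopen set given by a node of the
tree itself. It is defined by recursion, hence computable if the `Σ¹₁` conditions are given by
computable relations. An infinite path would name a `V` that contains no clopen set given by a
node of the tree, in particular none given by a prefix of the path, contradicting
`exists_marks_mem`. So there is no infinite path and `treeSet` of the tree is open. If some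
member `V` of the family were a neighbourhood of the empty set included in it, then `V` would
contain no clopen set given by a node, and the sequence encoding `V` would be an infinite path
after all. This is `exists_open_not_superset`.

Without computability this shows that `X` is not `𝒩`-based and that `O(X)` is not a continuous
image of `𝒩`. With computability it shows that a `Σ¹₁`-indexed family misses a computable open
set. For a family computable in a `Δ¹₁` oracle the list of pairs is no longer computable, but
its graph is `Σ¹₁` (`isSigma11_of_computableIn`), since `Σ¹₁` is closed under the operations
that generate the functions recursive in the oracle.
-/

namespace BaireClopens

open RepresentedSpace Filter Topology
open Encodable (encode)

/-! ### Finite prefixes -/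

theorem prefixOf_eq_map (p : Baire) (k : ℕ) : prefixOf p k = (List.range k).map p :=
  List.ext_getElem (by simp [prefixOf]) (by simp [prefixOf])

@[simp] theorem length_prefixOf (p : Baire) (k : ℕ) : (prefixOf p k).length = k := by
  simp [prefixOf]

theorem prefixOf_succ (p : Baire) (k : ℕ) : prefixOf p (k + 1) = prefixOf p k ++ [p k] := by
  simp [prefixOf_eq_map, List.range_succ]

theorem take_prefixOf (p : Baire) {i k : ℕ} (h : i ≤ k) :
    (prefixOf p k).take i = prefixOf p i := by
  simp [prefixOf_eq_map, ← List.map_take, List.take_range, h]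

theorem mem_prefixOf {p : Baire} {k a : ℕ} : a ∈ prefixOf p k ↔ ∃ i < k, p i = a := by
  simp [prefixOf_eq_map]

theorem isPrefix_of_prefix {u w : List ℕ} {p : Baire} (h : u <+: w) (hw : IsPrefix w p) :
    IsPrefix u p := by
  intro i hi
  rw [← hw i (hi.trans_le h.length_le)]
  exact h.getElem hi

theorem prefix_of_isPrefix {u w : List ℕ} {p : Baire} (hu : IsPrefix u p) (hw : IsPrefix w p)
    (h : u.length ≤ w.length) : u <+: w := by
  rw [isPrefix_iff_eq_prefixOf] at hu hw
  rw [List.prefix_iff_eq_take]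
  conv_rhs => rw [hw, take_prefixOf _ h]
  exact hu

theorem comparable_of_isPrefix {u w : List ℕ} {p : Baire} (hu : IsPrefix u p)
    (hw : IsPrefix w p) : u <+: w ∨ w <+: u :=
  (le_total u.length w.length).imp (prefix_of_isPrefix hu hw) (prefix_of_isPrefix hw hu)

/-- The finite sequence `w` followed by zeros. -/
def zeroExtend (w : List ℕ) : Baire := fun i => w.getD i 0

theorem isPrefix_append_zeros (w : List ℕ) (n : ℕ) :
    IsPrefix (w ++ List.replicate n 0) (zeroExtend w) := by
  intro i hi
  rw [List.getElem_append]
  split <;> simp_all [zeroExtend]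

theorem isPrefix_zeroExtend (w : List ℕ) : IsPrefix w (zeroExtend w) :=
  isPrefix_of_prefix (List.prefix_append _ _) (isPrefix_append_zeros w 0)

theorem isOpen_isPrefix (u : List ℕ) : IsOpen {p : Baire | IsPrefix u p} := by
  have h : {p : Baire | IsPrefix u p} =
      ⋂ i : Fin u.length, (fun x : Baire => x i) ⁻¹' {u[i]} := by
    ext x
    simp only [IsPrefix, Set.mem_ofPred_eq, Set.mem_iInter, Set.mem_preimage,
      Set.mem_singleton_iff]
    exact ⟨fun h i => (h i i.2).symm, fun h i hi => (h ⟨i, hi⟩).symm⟩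
  rw [h]
  exact isOpen_iInter_of_finite fun i => (isOpen_discrete _).preimage (continuous_apply _)

/-! ### Names of clopen sets -/

/-- `g` computes the characteristic function `χ` from finite prefixes: when defined at `u` it gives
the common value of `χ` on all extensions of `u`, and it is defined at some prefix of every
point. -/
def Evaluates (g : List ℕ → Option ℕ) (χ : Baire → Fin 2) : Prop :=
  (∀ u b, g u = some b → ∀ x, IsPrefix u x → b = χ x) ∧
    ∀ x, ∃ u, IsPrefix u x ∧ (g u).isSome

/-- The list of pairs `(u, v)` obtained from `g`: every `u` at which `g` takes a value `b` is
listed with all the constant sequences `v` of value `b`, and the other `u` with `v` empty. -/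
def nameOf (g : List ℕ → Option ℕ) : Baire := fun n =>
  encode ((Denumerable.ofNat (List ℕ × List ℕ) n).1,
    ((g (Denumerable.ofNat (List ℕ × List ℕ) n).1).map fun b =>
      List.replicate (Denumerable.ofNat (List ℕ × List ℕ) n).2.length b).getD [])

theorem exists_names_nameOf {g : List ℕ → Option ℕ} {χ : Baire → Fin 2} (h : Evaluates g χ) :
    ∃ f : clopens.carrier, f.1 = χ ∧ clopens.Names (nameOf g) f := by
  have hc : ContinuousOn (fun x _ => (χ x : ℕ) : Baire → Baire) baire.dom := by
    refine Continuous.continuousOn (continuous_iff_continuousAt.2 fun x => ?_)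
    obtain ⟨u, hu, hg⟩ := h.2 x
    obtain ⟨b, hb⟩ := Option.isSome_iff_exists.1 hg
    refine ContinuousAt.congr (f := fun _ _ => b) continuousAt_const ?_
    filter_upwards [(isOpen_isPrefix u).mem_nhds hu] with y hy
    rw [h.1 u b hb y hy]
  have hr : Realizes baire two (fun x _ => (χ x : ℕ)) χ := by
    rintro p x rfl
    rfl
  refine ⟨⟨χ, _, hc, hr⟩, rfl, _, hc, hr, fun p _ => ⟨?_, ?_⟩⟩
  · rintro u v ⟨n, hn⟩ hu
    obtain ⟨rfl, rfl⟩ := Prod.mk.inj (Encodable.encode_injective hn)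
    intro i hi
    have h0 := h.1 (Denumerable.ofNat (List ℕ × List ℕ) n).1
    generalize g (Denumerable.ofNat (List ℕ × List ℕ) n).1 = o at hi h0 ⊢
    cases o with
    | none => simp at hi
    | some b => simpa using h0 b rfl p hu
  · intro v hv
    obtain ⟨u, hu, hg⟩ := h.2 p
    obtain ⟨b, hb⟩ := Option.isSome_iff_exists.1 hg
    refine ⟨u, hu, encode (u, v), ?_⟩
    have : v = List.replicate v.length b :=
      List.eq_replicate_iff.2 ⟨rfl, fun a ha => by
        obtain ⟨i, hi, rfl⟩ := List.getElem_of_mem ha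
        rw [hv i hi, h.1 u b hb p hu]⟩
    simp [nameOf, hb, ← this]

/-- Pointwise convergence of the evaluating functions entails convergence of the clopen sets. -/
theorem eventually_of_evaluates (U : clopens.opens.carrier) {g : List ℕ → Option ℕ}
    {χ : Baire → Fin 2} (h : Evaluates g χ) {f : clopens.carrier} (hf : f.1 = χ) (hU : U.1 f)
    {G : ℕ → List ℕ → Option ℕ} {X : ℕ → Baire → Fin 2} (hG : ∀ k, Evaluates (G k) (X k))
    (hlim : ∀ u, ∀ᶠ k in atTop, G k u = g u) :
    ∀ᶠ k in atTop, ∀ f' : clopens.carrier, f'.1 = X k → U.1 f' := by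
  obtain ⟨F, hFc, hF⟩ := U.2
  obtain ⟨f₀, hf₀, hn⟩ := exists_names_nameOf h
  obtain rfl : f₀ = f := Subtype.ext (hf₀.trans hf.symm)
  choose f₁ hf₁ hn₁ using fun k => exists_names_nameOf (hG k)
  have ht : Tendsto (fun k => nameOf (G k)) atTop (𝓝[clopens.dom] (nameOf g)) := by
    refine tendsto_nhdsWithin_iff.2 ⟨tendsto_pi_nhds.2 fun n => ?_, .of_forall fun k => ⟨_, hn₁ k⟩⟩
    refine tendsto_const_nhds.congr' ?_
    filter_upwards [hlim (Denumerable.ofNat (List ℕ × List ℕ) n).1] with k hk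
    rw [nameOf, nameOf, hk]
  have h0 : F (nameOf g) ≠ fun _ => 0 := (hF _ _ hn).2 hU
  have := ((hFc _ ⟨_, hn⟩).tendsto.comp ht).eventually (isOpen_ne.mem_nhds h0)
  filter_upwards [this] with k hk f' hf'
  obtain rfl : f₁ k = f' := Subtype.ext ((hf₁ k).trans hf'.symm)
  exact (hF _ _ (hn₁ k)).1 hk

open Classical in
/-- The characteristic function of the union of the basic open sets given by the elements
of `B`. -/
noncomputable def indicator (B : Set (List ℕ)) (x : Baire) : Fin 2 :=
  if ∃ b ∈ B, IsPrefix b x then 1 else 0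

open Classical in
/-- The evaluation of `indicator B` at prefixes of length at least `M`. -/
noncomputable def evalIndicator (M : ℕ) (B : Set (List ℕ)) (u : List ℕ) : Option ℕ :=
  if u.length < M then none
  else if ∃ b ∈ B, b <+: u then some 1 else if ∃ b ∈ B, u <+: b then none else some 0

theorem evaluates_indicator (M : ℕ) {B : Set (List ℕ)}
    (hB : ∀ x, ∃ u, IsPrefix u x ∧ ∀ b ∈ B, u <+: b → IsPrefix b x) :
    Evaluates (evalIndicator M B) (indicator B) := by
  refine ⟨fun u b hb x hx => ?_, fun x => ?_⟩
  · unfold evalIndicator at hb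
    unfold indicator
    split_ifs at hb with h1 h2 h3
    · obtain ⟨c, hc, hcu⟩ := h2
      rw [if_pos ⟨c, hc, isPrefix_of_prefix hcu hx⟩]
      simpa using hb.symm
    · rw [if_neg]
      · simpa using hb.symm
      · rintro ⟨c, hc, hcx⟩
        exact (comparable_of_isPrefix hx hcx).elim (fun h => h3 ⟨c, hc, h⟩)
          fun h => h2 ⟨c, hc, h⟩
  · obtain ⟨u, hu, h⟩ := hB x
    have hle : ∀ {n}, u.length ≤ n → u <+: prefixOf x n := fun hn =>
      prefix_of_isPrefix hu (isPrefix_prefixOf x _) (by simpa using hn)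
    by_cases hx : ∃ b ∈ B, IsPrefix b x
    · obtain ⟨b, hb, hbx⟩ := hx
      refine ⟨prefixOf x (max M b.length), isPrefix_prefixOf _ _, ?_⟩
      have h2 : ∃ c ∈ B, c <+: prefixOf x (max M b.length) :=
        ⟨b, hb, prefix_of_isPrefix hbx (isPrefix_prefixOf _ _) (by simp)⟩
      rw [evalIndicator, if_neg (by simp), if_pos h2]
      rfl
    · refine ⟨prefixOf x (max M u.length), isPrefix_prefixOf _ _, ?_⟩
      have h2 : ¬ ∃ c ∈ B, c <+: prefixOf x (max M u.length) := fun ⟨c, hc, h'⟩ =>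
        hx ⟨c, hc, isPrefix_of_prefix h' (isPrefix_prefixOf _ _)⟩
      have h3 : ¬ ∃ c ∈ B, prefixOf x (max M u.length) <+: c := fun ⟨c, hc, h'⟩ =>
        hx ⟨c, hc, h c hc ((hle (le_max_right _ _)).trans h')⟩
      rw [evalIndicator, if_neg (by simp), if_neg h2, if_neg h3]
      rfl

theorem exists_isPrefix_of_finite {B : Set (List ℕ)} (hB : B.Finite) (x : Baire) :
    ∃ u, IsPrefix u x ∧ ∀ b ∈ B, u <+: b → IsPrefix b x := by
  obtain ⟨N, hN⟩ := (hB.image List.length).bddAbove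
  refine ⟨prefixOf x N, isPrefix_prefixOf _ _, fun b hb h => ?_⟩
  rw [← h.eq_of_length_le (by simpa using hN ⟨b, hb, rfl⟩)]
  exact isPrefix_prefixOf _ _

/-- The characteristic function of a clopen set, with values in `ℕ`. -/
def value (f : clopens.carrier) (x : Baire) : ℕ := Fin.val (n := 2) (f.1 x)

/-- A name `p` of a clopen set determines its value on extensions of `w` to be `b` by one of the
pairs encoded by elements of `l`. -/
def Tells (l : List ℕ) (w : List ℕ) (b : ℕ) : Prop :=
  ∃ e ∈ l, (Denumerable.ofNat (List ℕ × List ℕ) e).1 <+: w ∧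
    (Denumerable.ofNat (List ℕ × List ℕ) e).2.head? = some b

theorem Tells.mono {l l' w w' : List ℕ} {b : ℕ} (h : Tells l w b) (hl : l ⊆ l') (hw : w <+: w') :
    Tells l' w' b :=
  let ⟨e, he, h1, h2⟩ := h
  ⟨e, hl he, h1.trans hw, h2⟩

theorem prefixOf_subset (p : Baire) {m n : ℕ} (h : m ≤ n) : prefixOf p m ⊆ prefixOf p n := by
  intro a
  simp only [mem_prefixOf]
  exact fun ⟨i, hi, e⟩ => ⟨i, hi.trans_le h, e⟩

theorem Tells.eq {p : Baire} {f : clopens.carrier} (hp : clopens.Names p f) {t : ℕ}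
    {w : List ℕ} {b : ℕ} (h : Tells (prefixOf p t) w b) {x : Baire} (hx : IsPrefix w x) :
    value f x = b := by
  obtain ⟨F, -, hF, hc⟩ := hp
  obtain ⟨e, he, h1, h2⟩ := h
  obtain ⟨i, -, rfl⟩ := mem_prefixOf.1 he
  have h3 : IsPrefix (Denumerable.ofNat (List ℕ × List ℕ) (p i)).2 (F x) :=
    (hc x ⟨x, rfl⟩).1 (Denumerable.ofNat (List ℕ × List ℕ) (p i)).1 _
    ⟨i, (Denumerable.encode_ofNat (α := List ℕ × List ℕ) (p i)).symm⟩
    (isPrefix_of_prefix h1 hx)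
  obtain ⟨v, hv⟩ : ∃ v, (Denumerable.ofNat (List ℕ × List ℕ) (p i)).2 = b :: v := by
    cases h : (Denumerable.ofNat (List ℕ × List ℕ) (p i)).2 <;> simp_all
  rw [hv] at h3
  exact (hF x x rfl).symm.trans (h3 0 (by simp)).symm

theorem exists_tells {p : Baire} {f : clopens.carrier} (hp : clopens.Names p f) (x : Baire) :
    ∃ t n, Tells (prefixOf p t) (prefixOf x n) (value f x) := by
  obtain ⟨F, -, hF, hc⟩ := hp
  obtain ⟨u, hu, i, hi⟩ := (hc x ⟨x, rfl⟩).2 _ (isPrefix_prefixOf (F x) 1)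
  refine ⟨i + 1, u.length, p i, mem_prefixOf.2 ⟨i, by simp, rfl⟩, ?_, ?_⟩
  · simp [hi, ← isPrefix_iff_eq_prefixOf.1 hu]
  · have : F x 0 = value f x := hF x x rfl
    simpa [hi, prefixOf] using this

theorem eventually_tells {p : Baire} {f : clopens.carrier} (hp : clopens.Names p f)
    (w : List ℕ) : ∃ n, ∀ᶠ t in atTop,
      Tells (prefixOf p t) (w ++ List.replicate n 0) (value f (zeroExtend w)) := by
  obtain ⟨t, n, h⟩ := exists_tells hp (zeroExtend w)
  refine ⟨n, eventually_atTop.2 ⟨t, fun t' ht => h.mono (prefixOf_subset p ht) ?_⟩⟩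
  exact prefix_of_isPrefix (isPrefix_prefixOf _ _) (isPrefix_append_zeros w n) (by simp)

/-- One of the pairs encoded by the elements of `l` determines the value at `zeroExtend w`
to be `b`; the length of the prefix of `zeroExtend w` is bounded so as to make the condition
decidable. -/
def Says (l : List ℕ) (w : List ℕ) (b : ℕ) : Prop :=
  ∃ n < l.length, Tells l (w ++ List.replicate n 0) b

theorem Says.eq {p : Baire} {f : clopens.carrier} (hp : clopens.Names p f) {t : ℕ}
    {w : List ℕ} {b : ℕ} (h : Says (prefixOf p t) w b) : value f (zeroExtend w) = b :=
  let ⟨n, _, h⟩ := h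
  h.eq hp (isPrefix_append_zeros w n)

theorem eventually_says {p : Baire} {f : clopens.carrier} (hp : clopens.Names p f)
    (w : List ℕ) : ∀ᶠ t in atTop, Says (prefixOf p t) w (value f (zeroExtend w)) := by
  obtain ⟨n, h⟩ := eventually_tells hp w
  filter_upwards [h, eventually_gt_atTop n] with t ht hn
  exact ⟨n, by simpa using hn, ht⟩

/-! ### Open sets given by decidable conditions on prefixes of names -/

/-- A set of clopen sets that is recognized by a condition on the finite prefixes of names is an
open set, and a computable one if the condition is computable. -/
theorem exists_open {acc : List ℕ → Prop} {P : clopens.carrier → Prop}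
    (h : ∀ p f, clopens.Names p f → ((∃ n, acc (prefixOf p n)) ↔ P f)) :
    ∃ U : clopens.opens.carrier, U.1 = P ∧
      (ComputablePred acc → U ∈ clopens.opens.computablePoints) := by
  classical
  let F : Baire → Baire := fun p n => if acc (prefixOf p n) then 1 else 0
  have hFc : ContinuousOn F clopens.dom := by
    refine Continuous.continuousOn
      (continuous_pi fun n => continuous_iff_continuousAt.2 fun x => ?_)
    refine ContinuousAt.congr (f := fun _ => F x n) continuousAt_const ?_
    filter_upwards [(isOpen_isPrefix (prefixOf x n)).mem_nhds (isPrefix_prefixOf x n)] with y hy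
    have := isPrefix_iff_eq_prefixOf.1 hy
    simp only [length_prefixOf] at this
    simp [F, this]
  have hF : Realizes clopens sierpinski F P := by
    intro p f hp
    rw [← h p f hp]
    simp [sierpinski, F, funext_iff]
  let q : Baire := fun n => encode (Denumerable.ofNat (List ℕ) n,
    (List.range (Denumerable.ofNat (List ℕ) n).length).map fun i =>
      if acc ((Denumerable.ofNat (List ℕ) n).take i) then 1 else 0)
  have hl : ∀ p k, prefixOf (F p) k = (List.range (prefixOf p k).length).map fun i =>
      if acc ((prefixOf p k).take i) then 1 else 0 := by
    intro p k
    rw [prefixOf_eq_map, length_prefixOf]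
    refine List.map_congr_left fun i hi => ?_
    rw [take_prefixOf _ (List.mem_range.1 hi).le]
  have hq : Codes q clopens.dom F := by
    refine fun p _ => ⟨?_, fun v hv => ⟨prefixOf p v.length, isPrefix_prefixOf _ _,
      encode (prefixOf p v.length), ?_⟩⟩
    · rintro u v ⟨n, hn⟩ hu
      obtain ⟨rfl, rfl⟩ := Prod.mk.inj (Encodable.encode_injective hn)
      have := isPrefix_prefixOf (F p) (Denumerable.ofNat (List ℕ) n).length
      rwa [hl, ← isPrefix_iff_eq_prefixOf.1 hu] at this
    · conv_rhs => rw [isPrefix_iff_eq_prefixOf.1 hv, hl]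
      simp [q]
  refine ⟨⟨P, F, hFc, hF⟩, rfl, fun hacc => ⟨q, ?_, F, hFc, hF, hq⟩⟩
  have h1 : Computable fun u : List ℕ => if acc u then 1 else 0 :=
    (Computable.cond hacc.decide (Computable.const 1) (Computable.const 0)).of_eq
      fun u => by by_cases hu : acc u <;> simp [hu]
  have h2 : Computable₂ fun (u : List ℕ) (i : ℕ) => if acc (u.take i) then 1 else 0 :=
    h1.comp ((Primrec.list_take.comp Primrec.snd Primrec.fst).to_comp)
  have h3 : Computable fun u : List ℕ => (List.range u.length).map fun i =>
      if acc (u.take i) then 1 else 0 := by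
    have h4 := Computable.nat_rec (f := fun u : List ℕ => u.length) (g := fun _ => ([] : List ℕ))
      (h := fun u s => s.2 ++ [if acc (u.take s.1) then 1 else 0])
      Computable.list_length (Computable.const [])
      (Computable.list_append.comp (Computable.snd.comp Computable.snd)
        (Computable.list_cons.comp (h2.comp Computable.fst (Computable.fst.comp Computable.snd))
          (Computable.const []))).to₂
    refine h4.of_eq fun u => ?_
    have : ∀ n, (Nat.rec [] (fun y IH => IH ++ [if acc (u.take y) then 1 else 0]) n : List ℕ) =
        (List.range n).map fun i => if acc (u.take i) then 1 else 0 := by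
      intro n
      induction n with
      | zero => rfl
      | succ n ih => rw [List.range_succ, List.map_append, ← ih]; rfl
    exact this _
  exact Computable.encode.comp ((Computable.id.pair h3).comp (Computable.ofNat (List ℕ)))

/-! ### The open set of a tree -/

/-- The sequences `0 ^ k, 1, ⌜s⌝`. For fixed `k` and an infinite path `α`, the corresponding basic
open sets leave every compact set along the prefixes `s` of `α`, while all of them lie in the basic
open set of `0 ^ k`. -/
def testNode (k : ℕ) (s : List ℕ) : List ℕ := List.replicate k 0 ++ [1, encode s]

/-- The common initial part of the sequences `edgeNode k s n`. Followed by zeros it is the limit of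
these sequences as `n` tends to infinity. -/
def limitNode (k : ℕ) (s : List ℕ) : List ℕ := [k + 2, encode s]

/-- The sequences `k + 2, ⌜s⌝, 0 ^ n, 1`, representing the edge from `s` to `s ++ [n]`. -/
def edgeNode (k : ℕ) (s : List ℕ) (n : ℕ) : List ℕ := limitNode k s ++ (List.replicate n 0 ++ [1])

/-- The condition on a clopen set `f` at the node `s`. If `s` is in `T` then `f` must vanish at the
test point of `s`; moreover, if `f` vanishes at the limit point of `s`, hence near that point, then
the condition must hold at the finitely many children of `s` whose edge is marked by `f`. -/
inductive Good (T : Set (List ℕ)) (f : Baire → ℕ) (k : ℕ) : List ℕ → Prop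
  | leave (s : List ℕ) : s ∉ T → Good T f k s
  | limit (s : List ℕ) : f (zeroExtend (testNode k s)) = 0 →
      f (zeroExtend (limitNode k s)) = 1 → Good T f k s
  | step (s : List ℕ) (n : ℕ) : f (zeroExtend (testNode k s)) = 0 →
      (∀ x, IsPrefix (limitNode k s ++ List.replicate n 0) x → f x = 0) →
      (∀ m < n, f (zeroExtend (edgeNode k s m)) ≠ 0 → Good T f k (s ++ [m])) → Good T f k s

/-- The set of clopen sets attached to `T`. It is open when `T` has no infinite path. -/
def treeSet (T : Set (List ℕ)) (f : clopens.carrier) : Prop :=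
  value f (zeroExtend []) = 0 ∧ ∀ k, Good T (value f) k []

/-- `α` is an infinite path of `T`. -/
def IsPath (T : Set (List ℕ)) (α : Baire) : Prop := ∀ k, prefixOf α k ∈ T

theorem induction_of_no_path {T : Set (List ℕ)} (hT : ∀ α, ¬ IsPath T α) {P : List ℕ → Prop}
    (h : ∀ s, (s ∈ T → ∀ n, P (s ++ [n])) → P s) : P [] := by
  by_contra h0
  have h1 : ∀ s, ¬ P s → s ∈ T ∧ ∃ n, ¬ P (s ++ [n]) := by
    intro s hs
    by_contra hc
    refine hs (h s fun hsT n => ?_)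
    by_contra hn
    exact hc ⟨hsT, n, hn⟩
  have h2 : ∀ s, ∃ n, ¬ P s → ¬ P (s ++ [n]) := fun s => by
    by_cases hs : P s
    · exact ⟨0, fun h => absurd hs h⟩
    · exact ⟨_, fun _ => (h1 s hs).2.choose_spec⟩
  choose nx hnx using h2
  let L : ℕ → List ℕ := fun n => Nat.rec [] (fun _ l => l ++ [nx l]) n
  have hL : ∀ n, prefixOf (fun i => nx (L i)) n = L n := by
    intro n
    induction n with
    | zero => simp [prefixOf, L]
    | succ n ih => rw [prefixOf_succ, ih]
  have hP : ∀ n, ¬ P (L n) := by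
    intro n
    induction n with
    | zero => exact h0
    | succ n ih => exact hnx _ ih
  exact hT (fun i => nx (L i)) fun n => by rw [hL]; exact (h1 _ (hP n)).1

theorem value_eq_zero_or_one (f : clopens.carrier) (x : Baire) : value f x = 0 ∨ value f x = 1 := by
  have := (show Fin 2 from f.1 x).isLt
  change value f x < 2 at this
  omega

theorem exists_forall_value_eq (f : clopens.carrier) (w : List ℕ) :
    ∃ n, ∀ x, IsPrefix (w ++ List.replicate n 0) x → value f x = value f (zeroExtend w) := by
  obtain ⟨p, hp⟩ := clopens.surj f
  obtain ⟨n, h⟩ := eventually_tells hp w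
  obtain ⟨t, ht⟩ := h.exists
  exact ⟨n, fun x hx => ht.eq hp hx⟩

theorem good_of_forall_testNode {T : Set (List ℕ)} (hT : ∀ α, ¬ IsPath T α) (f : clopens.carrier)
    (k : ℕ) (h : ∀ s, value f (zeroExtend (testNode k s)) = 0) : Good T (value f) k [] := by
  refine induction_of_no_path hT fun s ih => ?_
  by_cases hs : s ∈ T
  · obtain h0 | h1 := value_eq_zero_or_one f (zeroExtend (limitNode k s))
    · obtain ⟨n, hn⟩ := exists_forall_value_eq f (limitNode k s)
      exact .step s n (h s) (fun x hx => (hn x hx).trans h0) fun m _ _ => ih hs m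
    · exact .limit s (h s) h1
  · exact .leave s hs

/-! ### Recognizing the open set of a tree by finite certificates -/

/-- The local condition on an element `(k, s)` of a certificate `S`, with the prefix `l` of a name
as evidence. The list `τ` contains the codes of the elements of the tree whose code is less than
the length of `l`. -/
def NodeValid (l τ : List ℕ) (S : List (ℕ × List ℕ)) (e : ℕ × List ℕ) : Prop :=
  (encode e.2 < l.length ∧ encode e.2 ∉ τ) ∨
    (Says l (testNode e.1 e.2) 0 ∧
      (Says l (limitNode e.1 e.2) 1 ∨
        ∃ n < l.length, Tells l (limitNode e.1 e.2 ++ List.replicate n 0) 0 ∧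
          ∀ m < n, Says l (edgeNode e.1 e.2 m) 0 ∨ (e.1, e.2 ++ [m]) ∈ S))

/-- A certificate `(j, S)` for membership in `treeSet T`: the clopen set vanishes on the basic open
set of `0 ^ j`, and `S` is a finite set of nodes that justify one another and contains
the roots of the conditions of index less than `j`. -/
def Valid (l τ : List ℕ) (c : ℕ × List (ℕ × List ℕ)) : Prop :=
  Tells l (List.replicate c.1 0) 0 ∧ (∀ k < c.1, (k, []) ∈ c.2) ∧ ∀ e ∈ c.2, NodeValid l τ c.2 e

/-- The certificate that is checked on a prefix of length `n`; every certificate is checked on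
arbitrarily long prefixes. -/
def certificate (n : ℕ) : ℕ × List (ℕ × List ℕ) := Denumerable.ofNat _ n.unpair.1

section

variable {T : Set (List ℕ)} {G : ℕ → List ℕ}

theorem Valid.treeSet (hG : ∀ m n, m ∈ G n ↔ m < n ∧ Denumerable.ofNat (List ℕ) m ∈ T)
    (hT : ∀ α, ¬ IsPath T α) {p : Baire} {f : clopens.carrier} (hp : clopens.Names p f) {t : ℕ}
    {c : ℕ × List (ℕ × List ℕ)} (h : Valid (prefixOf p t) (G t) c) : treeSet T f := by
  obtain ⟨h1, h2, h3⟩ := h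
  have h0 : ∀ x, IsPrefix (List.replicate c.1 0) x → value f x = 0 := fun x hx => h1.eq hp hx
  refine ⟨h0 _ (isPrefix_append_zeros [] c.1), fun k => ?_⟩
  by_cases hk : k < c.1
  · suffices (k, []) ∈ c.2 → Good T (value f) k [] from this (h2 k hk)
    refine induction_of_no_path hT (P := fun s => (k, s) ∈ c.2 → Good T (value f) k s)
      fun s ih hs => ?_
    by_cases hsT : s ∈ T
    · obtain ⟨ha, hb⟩ | ⟨ha, hb | ⟨n, -, hn, hm⟩⟩ := h3 _ hs
      · exact absurd ((hG _ _).2 ⟨by simpa using ha, by simpa using hsT⟩) hb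
      · exact .limit s (ha.eq hp) (hb.eq hp)
      · refine .step s n (ha.eq hp) (fun x hx => hn.eq hp hx) fun m hmn hne => ?_
        exact ih hsT m ((hm m hmn).resolve_left fun h => hne (h.eq hp))
    · exact .leave s hsT
  · refine good_of_forall_testNode hT f k fun s => h0 _ ?_
    refine isPrefix_of_prefix ?_ (isPrefix_zeroExtend _)
    refine ⟨List.replicate (k - c.1) 0 ++ [1, encode s], ?_⟩
    rw [← List.append_assoc, ← List.replicate_add, Nat.add_sub_cancel' (not_lt.1 hk), testNode]

theorem NodeValid.mono {l τ : List ℕ} {S S' : List (ℕ × List ℕ)} {e : ℕ × List ℕ}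
    (h : NodeValid l τ S e) (hS : S ⊆ S') : NodeValid l τ S' e :=
  h.imp_right (And.imp_right (Or.imp_right fun ⟨n, h1, h2, h3⟩ =>
    ⟨n, h1, h2, fun m hm => (h3 m hm).imp_right fun h => hS h⟩))

theorem Good.exists_certificate
    (hG : ∀ m n, m ∈ G n ↔ m < n ∧ Denumerable.ofNat (List ℕ) m ∈ T)
    {p : Baire} {f : clopens.carrier} (hp : clopens.Names p f) {k : ℕ} {s : List ℕ}
    (h : Good T (value f) k s) : ∃ S : List (ℕ × List ℕ), (k, s) ∈ S ∧
      ∀ e ∈ S, ∀ᶠ t in atTop, NodeValid (prefixOf p t) (G t) S e := by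
  induction h with
  | leave s hs =>
    refine ⟨[(k, s)], by simp, fun e he => ?_⟩
    obtain rfl := List.mem_singleton.1 he
    filter_upwards [eventually_gt_atTop (encode s)] with t ht
    exact .inl ⟨by simpa using ht, fun h => hs (by simpa using ((hG _ _).1 h).2)⟩
  | limit s h0 h1 =>
    refine ⟨[(k, s)], by simp, fun e he => ?_⟩
    obtain rfl := List.mem_singleton.1 he
    filter_upwards [eventually_says hp (testNode k s), eventually_says hp (limitNode k s)]
      with t ht ht'
    rw [h0] at ht
    rw [h1] at ht'
    exact .inr ⟨ht, .inl ht'⟩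
  | step s n h0 h1 _ ih =>
    have ih' : ∀ m, ∃ S : List (ℕ × List ℕ),
        (m < n → value f (zeroExtend (edgeNode k s m)) ≠ 0 → (k, s ++ [m]) ∈ S) ∧
        ∀ e ∈ S, ∀ᶠ t in atTop, NodeValid (prefixOf p t) (G t) S e := by
      intro m
      by_cases hm : m < n ∧ value f (zeroExtend (edgeNode k s m)) ≠ 0
      · obtain ⟨S, hS, hS'⟩ := ih m hm.1 hm.2
        exact ⟨S, fun _ _ => hS, hS'⟩
      · exact ⟨[], fun h h' => absurd ⟨h, h'⟩ hm, by simp⟩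
    choose S hS hS' using ih'
    obtain ⟨n', hn'⟩ := eventually_tells hp (limitNode k s)
    rw [h1 _ (isPrefix_append_zeros _ _)] at hn'
    have hsub : ∀ m < n', S m ⊆ (k, s) :: (List.range n').flatMap S :=
      fun m hm a ha => List.mem_cons_of_mem _ (List.mem_flatMap.2 ⟨m, List.mem_range.2 hm, ha⟩)
    refine ⟨(k, s) :: (List.range n').flatMap S, by simp, fun e he => ?_⟩
    obtain rfl | he := List.mem_cons.1 he
    · have h2 : ∀ m ∈ Finset.range n', ∀ᶠ t in atTop, Says (prefixOf p t) (edgeNode k s m) 0 ∨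
          (k, s ++ [m]) ∈ (k, s) :: (List.range n').flatMap S := by
        intro m hm
        by_cases hv : value f (zeroExtend (edgeNode k s m)) = 0
        · filter_upwards [eventually_says hp (edgeNode k s m)] with t ht
          exact .inl (hv ▸ ht)
        · refine .of_forall fun t => .inr (hsub m (Finset.mem_range.1 hm) (hS m ?_ hv))
          -- the edges from `n` on lie in the basic open set on which `f` vanishes
          by_contra hmn
          refine hv (h1 _ (isPrefix_of_prefix ?_ (isPrefix_zeroExtend _)))
          refine ⟨List.replicate (m - n) 0 ++ [1], ?_⟩
          rw [edgeNode, List.append_assoc, ← List.append_assoc (List.replicate n 0),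
            ← List.replicate_add, Nat.add_sub_cancel' (not_lt.1 hmn)]
      filter_upwards [eventually_says hp (testNode k s), hn', eventually_gt_atTop n',
        (Filter.eventually_all_finset _).2 h2] with t ha hb hc hd
      rw [h0] at ha
      exact .inr ⟨ha, .inr ⟨n', by simpa using hc, hb, fun m hm => hd m (Finset.mem_range.2 hm)⟩⟩
    · obtain ⟨m, hm, he⟩ := List.mem_flatMap.1 he
      filter_upwards [hS' m e he] with t ht
      exact ht.mono (hsub m (List.mem_range.1 hm))

theorem exists_valid_of_treeSet
    (hG : ∀ m n, m ∈ G n ↔ m < n ∧ Denumerable.ofNat (List ℕ) m ∈ T)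
    {p : Baire} {f : clopens.carrier} (hp : clopens.Names p f) (h : treeSet T f) :
    ∃ t, Valid (prefixOf p t) (G t) (certificate t) := by
  obtain ⟨j, hj⟩ := eventually_tells hp []
  rw [h.1] at hj
  choose S hS hS' using fun k => (h.2 k).exists_certificate hG hp
  let c : ℕ × List (ℕ × List ℕ) := (j, (List.range j).flatMap S)
  have h1 : ∀ e ∈ c.2.toFinset, ∀ᶠ t in atTop, NodeValid (prefixOf p t) (G t) c.2 e := by
    intro e he
    obtain ⟨k, hk, hek⟩ := List.mem_flatMap.1 (List.mem_toFinset.1 he)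
    filter_upwards [hS' k e hek] with t ht
    exact ht.mono fun a ha => List.mem_flatMap.2 ⟨k, hk, ha⟩
  obtain ⟨t₀, ht₀⟩ := eventually_atTop.1 (hj.and ((Filter.eventually_all_finset _).2 h1))
  have hc : certificate (Nat.pair (encode c) t₀) = c := by
    simp only [certificate, Nat.unpair_pair]
    exact Denumerable.ofNat_encode c
  obtain ⟨h2, h3⟩ := ht₀ _ (Nat.right_le_pair (encode c) t₀)
  refine ⟨Nat.pair (encode c) t₀, ?_⟩
  rw [hc]
  exact ⟨h2, fun k hk => List.mem_flatMap.2 ⟨k, List.mem_range.2 hk, hS k⟩,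
    fun e he => h3 e (List.mem_toFinset.2 he)⟩

end

/-! ### Computability of the certificates -/

theorem primrecPred_exists_lt {α : Type*} [Primcodable α] {p : α → ℕ → Prop} {f : α → ℕ}
    (hp : PrimrecRel p) (hf : Primrec f) : PrimrecPred fun a => ∃ n < f a, p a n :=
  (hp.swap.exists_mem_list.comp (Primrec.list_range.comp hf) Primrec.id).of_eq (by simp)

theorem primrecPred_forall_lt {α : Type*} [Primcodable α] {p : α → ℕ → Prop} {f : α → ℕ}
    (hp : PrimrecRel p) (hf : Primrec f) : PrimrecPred fun a => ∀ n < f a, p a n :=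
  (hp.swap.forall_mem_list.comp (Primrec.list_range.comp hf) Primrec.id).of_eq (by simp)

theorem primrecPred_forall_mem {α β : Type*} [Primcodable α] [Primcodable β] {p : α → β → Prop}
    {f : α → List β} (hp : PrimrecRel p) (hf : Primrec f) :
    PrimrecPred fun a => ∀ b ∈ f a, p a b :=
  hp.swap.forall_mem_list.comp hf Primrec.id

theorem primrecPred_exists_mem {α β : Type*} [Primcodable α] [Primcodable β] {p : α → β → Prop}
    {f : α → List β} (hp : PrimrecRel p) (hf : Primrec f) :
    PrimrecPred fun a => ∃ b ∈ f a, p a b :=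
  hp.swap.exists_mem_list.comp hf Primrec.id

theorem primrecPred_mem {α β : Type*} [Primcodable α] [Primcodable β]
    {b : α → β} {f : α → List β} (hb : Primrec b) (hf : Primrec f) :
    PrimrecPred fun a => b a ∈ f a :=
  (primrecPred_exists_mem (p := fun a x => x = b a)
    (Primrec.eq.comp Primrec.snd (hb.comp Primrec.fst)) hf).of_eq (by simp)

theorem primrecPred_prefix {α : Type*} [Primcodable α] {u w : α → List ℕ} (hu : Primrec u)
    (hw : Primrec w) : PrimrecPred fun a => u a <+: w a :=
  (Primrec.eq.comp hu (Primrec.list_take.comp (Primrec.list_length.comp hu) hw)).of_eq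
    fun _ => List.prefix_iff_eq_take.symm

theorem primrec_replicate (a : ℕ) : Primrec fun n => List.replicate n a :=
  (Primrec.list_map Primrec.list_range (Primrec.const a).to₂).of_eq fun n => by simp

theorem primrecPred_tells {α : Type*} [Primcodable α] {l w : α → List ℕ} (b : ℕ)
    (hl : Primrec l) (hw : Primrec w) : PrimrecPred fun a => Tells (l a) (w a) b := by
  refine primrecPred_exists_mem (PrimrecPred.and ?_ ?_) hl
  · exact primrecPred_prefix (Primrec.fst.comp ((Primrec.ofNat _).comp Primrec.snd))
      (hw.comp Primrec.fst)
  · exact Primrec.eq.comp (Primrec.list_head?.comp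
      (Primrec.snd.comp ((Primrec.ofNat _).comp Primrec.snd))) (Primrec.const _)

theorem primrecPred_says {α : Type*} [Primcodable α] {l w : α → List ℕ} (b : ℕ)
    (hl : Primrec l) (hw : Primrec w) : PrimrecPred fun a => Says (l a) (w a) b := by
  refine primrecPred_exists_lt (primrecPred_tells b ?_ ?_) (Primrec.list_length.comp hl)
  · exact hl.comp Primrec.fst
  · exact Primrec.list_append.comp (hw.comp Primrec.fst) ((primrec_replicate 0).comp Primrec.snd)

theorem primrec_testNode : Primrec₂ testNode :=
  Primrec.list_append.comp ((primrec_replicate 0).comp Primrec.fst)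
    (Primrec.list_cons.comp (Primrec.const 1)
      (Primrec.list_cons.comp (Primrec.encode.comp Primrec.snd) (Primrec.const [])))

theorem primrec_limitNode : Primrec₂ limitNode :=
  Primrec.list_cons.comp (Primrec.succ.comp (Primrec.succ.comp Primrec.fst))
    (Primrec.list_cons.comp (Primrec.encode.comp Primrec.snd) (Primrec.const []))

theorem primrec_edgeNode : Primrec fun x : (ℕ × List ℕ) × ℕ => edgeNode x.1.1 x.1.2 x.2 :=
  Primrec.list_append.comp (primrec_limitNode.comp (Primrec.fst.comp Primrec.fst)
      (Primrec.snd.comp Primrec.fst))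
    (Primrec.list_append.comp ((primrec_replicate 0).comp Primrec.snd) (Primrec.const [1]))

theorem primrecPred_nodeValid :
    PrimrecPred fun x : ((List ℕ × List ℕ) × List (ℕ × List ℕ)) × (ℕ × List ℕ) =>
      NodeValid x.1.1.1 x.1.1.2 x.1.2 x.2 := by
  have hl : Primrec fun x : ((List ℕ × List ℕ) × List (ℕ × List ℕ)) × (ℕ × List ℕ) =>
      x.1.1.1 := Primrec.fst.comp (Primrec.fst.comp Primrec.fst)
  have hτ : Primrec fun x : ((List ℕ × List ℕ) × List (ℕ × List ℕ)) × (ℕ × List ℕ) =>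
      x.1.1.2 := Primrec.snd.comp (Primrec.fst.comp Primrec.fst)
  have hS : Primrec fun x : ((List ℕ × List ℕ) × List (ℕ × List ℕ)) × (ℕ × List ℕ) =>
      x.1.2 := Primrec.snd.comp Primrec.fst
  have hk : Primrec fun x : ((List ℕ × List ℕ) × List (ℕ × List ℕ)) × (ℕ × List ℕ) =>
      x.2.1 := Primrec.fst.comp Primrec.snd
  have hs : Primrec fun x : ((List ℕ × List ℕ) × List (ℕ × List ℕ)) × (ℕ × List ℕ) =>
      x.2.2 := Primrec.snd.comp Primrec.snd
  have h1 := (Primrec.nat_lt.comp (Primrec.encode.comp hs) (Primrec.list_length.comp hl)).and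
    (primrecPred_mem (Primrec.encode.comp hs) hτ).not
  have h2 := primrecPred_says 0 hl (primrec_testNode.comp hk hs)
  have h3 := primrecPred_says 1 hl (primrec_limitNode.comp hk hs)
  have h4 := primrecPred_tells 0 (hl.comp (Primrec.fst (β := ℕ))) (Primrec.list_append.comp
      (primrec_limitNode.comp (hk.comp Primrec.fst) (hs.comp Primrec.fst))
      ((primrec_replicate 0).comp Primrec.snd))
  have hf := Primrec.fst.comp (Primrec.fst (α :=
    (((List ℕ × List ℕ) × List (ℕ × List ℕ)) × (ℕ × List ℕ)) × ℕ) (β := ℕ))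
  have h5 := primrecPred_says 0 (hl.comp hf)
    (primrec_edgeNode.comp (((hk.comp hf).pair (hs.comp hf)).pair Primrec.snd))
  have h6 := primrecPred_mem ((hk.comp hf).pair (Primrec.list_append.comp (hs.comp hf)
    (Primrec.list_cons.comp Primrec.snd (Primrec.const [])))) (hS.comp hf)
  have h7 := primrecPred_forall_lt (h5.or h6).primrecRel
    (Primrec.snd (α := ((List ℕ × List ℕ) × List (ℕ × List ℕ)) × (ℕ × List ℕ)) (β := ℕ))
  exact h1.or (h2.and (h3.or (primrecPred_exists_lt (h4.and h7).primrecRel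
    (Primrec.list_length.comp hl))))

theorem primrecPred_valid :
    PrimrecPred fun x : (List ℕ × List ℕ) × (ℕ × List (ℕ × List ℕ)) =>
      Valid x.1.1 x.1.2 x.2 := by
  refine PrimrecPred.and ?_ (PrimrecPred.and (primrecPred_forall_lt (primrecPred_mem ?_ ?_) ?_)
    (primrecPred_forall_mem (f := fun x : (List ℕ × List ℕ) × (ℕ × List (ℕ × List ℕ)) => x.2.2)
      (p := fun x e => NodeValid x.1.1 x.1.2 x.2.2 e) ?_ (Primrec.snd.comp Primrec.snd)))
  · exact primrecPred_tells 0 (Primrec.fst.comp Primrec.fst)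
      ((primrec_replicate 0).comp (Primrec.fst.comp Primrec.snd))
  · exact Primrec.snd.pair (Primrec.const [])
  · exact Primrec.snd.comp (Primrec.snd.comp Primrec.fst)
  · exact Primrec.fst.comp Primrec.snd
  · exact primrecPred_nodeValid.comp (((Primrec.fst.comp Primrec.fst).pair
      (Primrec.snd.comp (Primrec.snd.comp Primrec.fst))).pair Primrec.snd)

theorem computablePred_comp {α β : Type*} [Primcodable α] [Primcodable β] {p : β → Prop}
    {f : α → β} (hp : ComputablePred p) (hf : Computable f) : ComputablePred fun a => p (f a) := by
  classical
  exact ⟨inferInstance, hp.decide.comp hf⟩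

/-- If `T` has no infinite path then `treeSet T` is open, and it is a computable open set if `T`
is computable. -/
theorem exists_open_treeSet {T : Set (List ℕ)} {G : ℕ → List ℕ}
    (hG : ∀ m n, m ∈ G n ↔ m < n ∧ Denumerable.ofNat (List ℕ) m ∈ T) (hT : ∀ α, ¬ IsPath T α) :
    ∃ U : clopens.opens.carrier, U.1 = treeSet T ∧
      (Computable G → U ∈ clopens.opens.computablePoints) := by
  obtain ⟨U, hU, hc⟩ := exists_open (P := treeSet T)
    (acc := fun l => Valid l (G l.length) (certificate l.length)) fun p f hp =>
      ⟨fun ⟨n, h⟩ => Valid.treeSet (t := n) hG hT hp (by simpa using h), fun h => by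
        simpa using exists_valid_of_treeSet hG hp h⟩
  refine ⟨U, hU, fun h => hc (computablePred_comp primrecPred_valid.computablePred
    ((Computable.id.pair (h.comp Computable.list_length)).pair ?_))⟩
  exact ((Primrec.ofNat _).comp
    (Primrec.fst.comp (Primrec.unpair.comp Primrec.list_length))).to_comp

/-! ### Clopen sets that converge to the empty set along an infinite path -/

/-- The clopen set given by `marks k s` marks all edges on the way from the root to `s`, and
contains the test point of `s`. -/
def marks (k : ℕ) (s : List ℕ) : List (List ℕ) :=
  testNode k s :: (List.range s.length).map fun i => edgeNode k (s.take i) (s.getD i 0)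

theorem value_eq_indicator {f : clopens.carrier} {B : Set (List ℕ)} (hf : f.1 = indicator B)
    (x : Baire) : value f x = indicator B x := by
  rw [value, hf]

theorem value_eq_one {f : clopens.carrier} {B : Set (List ℕ)} (hf : f.1 = indicator B)
    {x : Baire} {b : List ℕ} (hb : b ∈ B) (hx : IsPrefix b x) : value f x = 1 := by
  rw [value_eq_indicator hf, indicator, if_pos ⟨b, hb, hx⟩]
  rfl

theorem value_eq_zero {f : clopens.carrier} {B : Set (List ℕ)} (hf : f.1 = indicator B)
    {x : Baire} (hx : ∀ b ∈ B, ¬ IsPrefix b x) : value f x = 0 := by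
  rw [value_eq_indicator hf, indicator, if_neg fun ⟨b, hb, h⟩ => hx b hb h]
  rfl

theorem exists_clopen (B : List (List ℕ)) :
    ∃ f : clopens.carrier, f.1 = indicator {b | b ∈ B} ∧
      clopens.Names (nameOf (evalIndicator 0 {b | b ∈ B})) f :=
  exists_names_nameOf (evaluates_indicator 0 (exists_isPrefix_of_finite B.finite_toSet))

/-- The empty clopen set. -/
noncomputable def emptyClopen : clopens.carrier := (exists_clopen []).choose

theorem emptyClopen_eq : emptyClopen.1 = indicator ∅ :=
  (exists_clopen []).choose_spec.1.trans (congrArg indicator (by simp))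

theorem treeSet_emptyClopen {T : Set (List ℕ)} (hT : ∀ α, ¬ IsPath T α) :
    treeSet T emptyClopen :=
  have h : ∀ x, value emptyClopen x = 0 := fun _ => value_eq_zero emptyClopen_eq (by simp)
  ⟨h _, fun k => good_of_forall_testNode hT _ k fun _ => h _⟩

theorem apply_of_isPrefix_edgeNode {k : ℕ} {s : List ℕ} {n : ℕ} {x : Baire}
    (h : IsPrefix (edgeNode k s n) x) : x (n + 2) = 1 := by
  rw [← h (n + 2) (by simp [edgeNode, limitNode])]
  simp [edgeNode, limitNode]

theorem getD_prefixOf {α : Baire} {i k : ℕ} (h : i < k) : (prefixOf α k).getD i 0 = α i := by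
  simp [prefixOf, h]

theorem not_treeSet_of_marks {T : Set (List ℕ)} {k : ℕ} {s : List ℕ} (hs : ∀ i, s.take i ∈ T)
    {f : clopens.carrier} (hf : f.1 = indicator {b | b ∈ marks k s}) : ¬ treeSet T f := by
  have key : ∀ s', Good T (value f) k s' → s' <+: s → False := by
    intro s' h
    induction h with
    | leave s' h' => exact fun hp => h' (List.prefix_iff_eq_take.1 hp ▸ hs _)
    | limit s' _ h1 =>
      intro _
      rw [value_eq_zero hf] at h1
      · exact absurd h1 (by simp)
      · intro b hb hx
        obtain rfl | hb := List.mem_cons.1 hb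
        · -- the test point starts with `0` or `1`, the limit point with `k + 2`
          have := hx 0 (by simp [testNode])
          cases k <;> simp [testNode, zeroExtend, limitNode, List.replicate_succ] at this
        · obtain ⟨i, -, rfl⟩ := List.mem_map.1 hb
          exact absurd (apply_of_isPrefix_edgeNode hx) (by simp [zeroExtend, limitNode])
    | step s' n h0 h1 _ ih =>
      intro hp
      obtain rfl | hne := eq_or_ne s' s
      · rw [value_eq_one hf (b := testNode k s') (by simp [marks]) (isPrefix_zeroExtend _)] at h0
        exact absurd h0 (by simp)
      · have hlt : s'.length < s.length := by
          by_contra hlt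
          exact hne (hp.eq_of_length_le (not_lt.1 hlt))
        have hs' : s' = s.take s'.length := List.prefix_iff_eq_take.1 hp
        have hv : value f (zeroExtend (edgeNode k s' (s.getD s'.length 0))) = 1 := by
          refine value_eq_one hf (b := edgeNode k s' (s.getD s'.length 0)) ?_
            (isPrefix_zeroExtend _)
          refine List.mem_cons_of_mem _ (List.mem_map.2 ⟨s'.length, List.mem_range.2 hlt, ?_⟩)
          rw [← hs']
        have hm : s.getD s'.length 0 < n := by
          by_contra hmn
          rw [h1 _ (isPrefix_of_prefix ?_ (isPrefix_zeroExtend _))] at hv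
          · exact absurd hv (by simp)
          refine ⟨List.replicate (s.getD s'.length 0 - n) 0 ++ [1], ?_⟩
          rw [edgeNode, List.append_assoc, ← List.append_assoc (List.replicate n 0),
            ← List.replicate_add, Nat.add_sub_cancel' (not_lt.1 hmn)]
        refine ih _ hm (by rw [hv]; simp) ?_
        rw [List.prefix_iff_eq_take]
        rw [List.length_append, List.length_singleton, ← List.take_concat_get' s _ hlt,
          List.getD_eq_getElem _ _ hlt, ← hs']
  exact fun h => key _ (h.2 k) (List.nil_prefix)

theorem evalIndicator_congr {M : ℕ} {B B' : Set (List ℕ)} {u : List ℕ}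
    (h : M ≤ u.length → ∀ b, b <+: u ∨ u <+: b → (b ∈ B ↔ b ∈ B')) :
    evalIndicator M B u = evalIndicator M B' u := by
  unfold evalIndicator
  by_cases hu : u.length < M
  · simp [hu]
  · have h1 : (∃ b ∈ B, b <+: u) ↔ ∃ b ∈ B', b <+: u :=
      exists_congr fun b => and_congr_left fun hb => h (not_lt.1 hu) b (.inl hb)
    have h2 : (∃ b ∈ B, u <+: b) ↔ ∃ b ∈ B', u <+: b :=
      exists_congr fun b => and_congr_left fun hb => h (not_lt.1 hu) b (.inr hb)
    rw [if_neg hu, if_neg hu]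
    split_ifs <;> simp_all

theorem getElem_eq_of_comparable {b u : List ℕ} (h : b <+: u ∨ u <+: b) {i : ℕ}
    (hb : i < b.length) (hu : i < u.length) : b[i] = u[i] :=
  h.elim (fun h => h.getElem hb) fun h => (h.getElem hu).symm

/-- The edges of the infinite path `α`. -/
def pathMarks (k : ℕ) (α : Baire) : Set (List ℕ) :=
  Set.range fun i => edgeNode k (prefixOf α i) (α i)

theorem encode_prefixOf_inj {α : Baire} {i j : ℕ}
    (h : encode (prefixOf α i) = encode (prefixOf α j)) : i = j := by
  simpa using congrArg List.length (Encodable.encode_injective h)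

theorem le_encode_prefixOf (α : Baire) (i : ℕ) : i ≤ encode (prefixOf α i) := by
  simpa using Encodable.length_le_encode (prefixOf α i)

theorem evaluates_pathMarks (M k : ℕ) (α : Baire) :
    Evaluates (evalIndicator M (pathMarks k α)) (indicator (pathMarks k α)) := by
  refine evaluates_indicator M fun x => ?_
  by_cases hx : ∃ i, x 1 = encode (prefixOf α i)
  · obtain ⟨i, hi⟩ := hx
    refine ⟨prefixOf x (α i + 3), isPrefix_prefixOf _ _, ?_⟩
    rintro _ ⟨j, rfl⟩ h
    have h1 := h.getElem (i := 1) (by simp)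
    obtain rfl : j = i := encode_prefixOf_inj (.symm (hi.symm.trans (by
      simpa [prefixOf, edgeNode, limitNode] using h1)))
    rw [← h.eq_of_length_le (by simp [edgeNode, limitNode])]
    exact isPrefix_prefixOf _ _
  · refine ⟨prefixOf x 2, isPrefix_prefixOf _ _, ?_⟩
    rintro _ ⟨j, rfl⟩ h
    have h1 := h.getElem (i := 1) (by simp)
    exact absurd ⟨j, by simpa [prefixOf, edgeNode, limitNode] using h1⟩ hx

theorem eventually_evalIndicator_pathMarks (α : Baire) (u : List ℕ) :
    ∀ᶠ k in atTop, evalIndicator 1 (pathMarks k α) u = evalIndicator 1 ∅ u := by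
  filter_upwards [eventually_gt_atTop (u.getD 0 0)] with k hk
  refine evalIndicator_congr fun hu b hb => ⟨?_, by simp⟩
  rintro ⟨i, rfl⟩
  have := getElem_eq_of_comparable (i := 0) hb (by simp [edgeNode, limitNode]) hu
  simp [edgeNode, limitNode] at this
  rw [List.getD_eq_getElem _ _ hu, ← this] at hk
  omega

theorem eventually_evalIndicator_marks (k : ℕ) (α : Baire) (u : List ℕ) :
    ∀ᶠ j in atTop, evalIndicator (k + 2) {b | b ∈ marks k (prefixOf α j)} u =
      evalIndicator (k + 2) (pathMarks k α) u := by
  filter_upwards [eventually_gt_atTop (u.getD (k + 1) 0), eventually_gt_atTop (u.getD 1 0)]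
    with j hj hj'
  refine evalIndicator_congr fun hu b hb => ?_
  have hlen : k + 1 < u.length := by omega
  rw [List.getD_eq_getElem _ _ hlen] at hj
  rw [List.getD_eq_getElem _ _ (by omega)] at hj'
  constructor
  · intro h
    obtain rfl | h := List.mem_cons.1 h
    · have := getElem_eq_of_comparable (i := k + 1) hb (by simp [testNode]) hlen
      rw [← this] at hj
      simp [testNode] at hj
      exact absurd hj (not_lt.2 (le_encode_prefixOf α j))
    · obtain ⟨i, hi, rfl⟩ := List.mem_map.1 h
      rw [List.mem_range, length_prefixOf] at hi
      rw [take_prefixOf α hi.le, getD_prefixOf hi]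
      exact ⟨i, rfl⟩
  · rintro ⟨i, rfl⟩
    have := getElem_eq_of_comparable (i := 1) hb (by simp [edgeNode, limitNode]) (by omega)
    rw [← this] at hj'
    simp [edgeNode, limitNode] at hj'
    have hi := (le_encode_prefixOf α i).trans_lt hj'
    refine List.mem_cons_of_mem _ (List.mem_map.2 ⟨i, by simpa using hi, ?_⟩)
    rw [take_prefixOf α hi.le, getD_prefixOf hi]

/-- Every open neighbourhood of the empty set contains some of the clopen sets associated with the
prefixes of an infinite path `α`: the unions of all edges of `α` converge to the empty set as `k`
tends to infinity, and each of them is the limit of the clopen sets that mark finitely many edges,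
as their test points have no accumulation point. -/
theorem exists_marks_mem (U : clopens.opens.carrier) (hU : U.1 emptyClopen) (α : Baire) :
    ∃ k j, ∀ f : clopens.carrier, f.1 = indicator {b | b ∈ marks k (prefixOf α j)} → U.1 f := by
  obtain ⟨k, hk⟩ := (eventually_of_evaluates U
    (evaluates_indicator 1 (exists_isPrefix_of_finite Set.finite_empty)) emptyClopen_eq hU
    (fun k => evaluates_pathMarks 1 k α) (eventually_evalIndicator_pathMarks α)).exists
  obtain ⟨f, hf, -⟩ := exists_names_nameOf (evaluates_pathMarks 1 k α)
  obtain ⟨j, hj⟩ := (eventually_of_evaluates U (evaluates_pathMarks (k + 2) k α) hf (hk f hf)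
    (fun j => evaluates_indicator (k + 2)
      (exists_isPrefix_of_finite (marks k (prefixOf α j)).finite_toSet))
    (eventually_evalIndicator_marks k α)).exists
  exact ⟨k, j, hj⟩

/-- The entry `e` of a name of an open set of clopen sets shows that the clopen set given by `B`
belongs to the open set. -/
def Accepts (B : List (List ℕ)) (e : ℕ) : Prop :=
  (∀ i < (Denumerable.ofNat (List ℕ × List ℕ) e).1.length,
    (Denumerable.ofNat (List ℕ × List ℕ) e).1.getD i 0 =
      nameOf (evalIndicator 0 {b | b ∈ B}) i) ∧
    ∃ a ∈ (Denumerable.ofNat (List ℕ × List ℕ) e).2, a ≠ 0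

theorem exists_accepts_iff {x : Baire} {U : clopens.opens.carrier} (hx : clopens.opens.Names x U)
    {B : List (List ℕ)} {f : clopens.carrier} (hf : f.1 = indicator {b | b ∈ B}) :
    (∃ j, Accepts B (x j)) ↔ U.1 f := by
  obtain ⟨F, -, hF, hc⟩ := hx
  obtain ⟨f', hf', hn⟩ := exists_clopen B
  obtain rfl : f' = f := Subtype.ext (hf'.trans hf.symm)
  obtain ⟨h1, h2⟩ := hc _ ⟨_, hn⟩
  have h3 : (F (nameOf (evalIndicator 0 {b | b ∈ B})) ≠ fun _ => 0) ↔ U.1 f' := hF _ _ hn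
  rw [← h3]
  constructor
  · rintro ⟨j, ha, b, hb, hb0⟩
    have h4 : IsPrefix (Denumerable.ofNat (List ℕ × List ℕ) (x j)).2
        (F (nameOf (evalIndicator 0 {b | b ∈ B}))) := by
      refine h1 (Denumerable.ofNat (List ℕ × List ℕ) (x j)).1 _
        ⟨j, (Denumerable.encode_ofNat (α := List ℕ × List ℕ) (x j)).symm⟩ fun i hi => ?_
      rw [← ha i hi, List.getD_eq_getElem _ _ hi]
    obtain ⟨i, hi, rfl⟩ := List.getElem_of_mem hb
    intro h0
    exact hb0 ((h4 i hi).trans (congrFun h0 i))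
  · intro h0
    obtain ⟨i, hi⟩ := Function.ne_iff.1 h0
    obtain ⟨u, hu, j, hj⟩ := h2 _ (isPrefix_prefixOf _ (i + 1))
    refine ⟨j, ?_⟩
    rw [Accepts, hj, Denumerable.ofNat_encode]
    exact ⟨fun n hn => by rw [List.getD_eq_getElem _ _ hn]; exact hu n hn,
      _, mem_prefixOf.2 ⟨i, by simp, rfl⟩, hi⟩

/-! ### Closure properties of computable predicates -/

section

variable {α : Type*} [Primcodable α]

theorem computablePred_and {p q : α → Prop} (hp : ComputablePred p) (hq : ComputablePred q) :
    ComputablePred fun a => p a ∧ q a := by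
  classical
  exact ⟨inferInstance, (Primrec.and.to_comp.comp hp.decide hq.decide).of_eq fun a => by simp⟩

theorem computablePred_imp {p q : α → Prop} (hp : ComputablePred p) (hq : ComputablePred q) :
    ComputablePred fun a => p a → q a :=
  (computablePred_and hp hq.not).not.of_eq fun a => by tauto

theorem computablePred_forall_lt {p : α → ℕ → Prop} {f : α → ℕ}
    (hp : ComputablePred fun x : α × ℕ => p x.1 x.2) (hf : Computable f) :
    ComputablePred fun a => ∀ n < f a, p a n := by
  classical
  have h := Computable.nat_rec (f := f) (g := fun _ => true)
    (h := fun a s => s.2 && decide (p a s.1)) hf (Computable.const true)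
    (Primrec.and.to_comp.comp (Computable.snd.comp Computable.snd)
      (hp.decide.comp (Computable.fst.pair (Computable.fst.comp Computable.snd)))).to₂
  refine ⟨inferInstance, h.of_eq fun a => ?_⟩
  have : ∀ n, (Nat.rec true (fun y IH => IH && decide (p a y)) n : Bool) =
      decide (∀ m < n, p a m) := by
    intro n
    induction n with
    | zero => simp
    | succ n ih =>
      simp only [ih, ← Bool.decide_and]
      exact decide_eq_decide.2 Nat.forall_lt_succ_right.symm
  exact this _

end

theorem primrecPred_imp {α : Type*} [Primcodable α] {p q : α → Prop} (hp : PrimrecPred p)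
    (hq : PrimrecPred q) : PrimrecPred fun a => p a → q a :=
  (hp.not.or hq).of_eq fun _ => imp_iff_not_or.symm

theorem primrec_marks : Primrec₂ marks := by
  refine Primrec.list_cons.comp primrec_testNode (Primrec.list_map
    (Primrec.list_range.comp (Primrec.list_length.comp Primrec.snd)) ?_)
  exact primrec_edgeNode.comp (((Primrec.fst.comp Primrec.fst).pair
    (Primrec.list_take.comp Primrec.snd (Primrec.snd.comp Primrec.fst))).pair
    ((Primrec.list_getD 0).comp (Primrec.snd.comp Primrec.fst) Primrec.snd))

theorem primrec_evalIndicator :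
    Primrec₂ fun (B : List (List ℕ)) (u : List ℕ) => evalIndicator 0 {b | b ∈ B} u := by
  classical
  have h1 : PrimrecPred fun x : List (List ℕ) × List ℕ => ∃ b ∈ x.1, b <+: x.2 :=
    primrecPred_exists_mem (primrecPred_prefix Primrec.snd
      (Primrec.snd.comp Primrec.fst)).primrecRel Primrec.fst
  have h2 : PrimrecPred fun x : List (List ℕ) × List ℕ => ∃ b ∈ x.1, x.2 <+: b :=
    primrecPred_exists_mem (primrecPred_prefix (Primrec.snd.comp Primrec.fst)
      Primrec.snd).primrecRel Primrec.fst
  exact (Primrec.ite h1 (Primrec.const (some 1)) (Primrec.ite h2 (Primrec.const none)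
    (Primrec.const (some 0)))).of_eq fun x => by
      simp only [evalIndicator, Nat.not_lt_zero, if_false, Set.mem_ofPred_eq]
      congr!

theorem primrec_nameOf :
    Primrec₂ fun (B : List (List ℕ)) (i : ℕ) => nameOf (evalIndicator 0 {b | b ∈ B}) i := by
  have hd : Primrec fun x : List (List ℕ) × ℕ => Denumerable.ofNat (List ℕ × List ℕ) x.2 :=
    (Primrec.ofNat _).comp Primrec.snd
  have he := primrec_evalIndicator.comp (Primrec.fst (α := List (List ℕ)) (β := ℕ))
    (Primrec.fst.comp hd)
  have hr : Primrec₂ fun (x : List (List ℕ) × ℕ) (b : ℕ) =>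
      List.replicate (Denumerable.ofNat (List ℕ × List ℕ) x.2).2.length b :=
    (Primrec.list_map (Primrec.list_range.comp (Primrec.list_length.comp (Primrec.snd.comp
      (hd.comp Primrec.fst)))) (Primrec.snd.comp Primrec.fst).to₂).of_eq fun x => by simp
  exact Primrec.encode.comp ((Primrec.fst.comp hd).pair
    (Primrec.option_getD.comp (Primrec.option_map he hr) (Primrec.const [])))

theorem primrecRel_accepts : PrimrecRel Accepts := by
  have hd : Primrec fun x : List (List ℕ) × ℕ => Denumerable.ofNat (List ℕ × List ℕ) x.2 :=
    (Primrec.ofNat _).comp Primrec.snd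
  have h1 : PrimrecRel fun (x : List (List ℕ) × ℕ) (i : ℕ) =>
      (Denumerable.ofNat (List ℕ × List ℕ) x.2).1.getD i 0 =
        nameOf (evalIndicator 0 {b | b ∈ x.1}) i :=
    Primrec.eq.comp ((Primrec.list_getD 0).comp (Primrec.fst.comp (hd.comp Primrec.fst))
      Primrec.snd) (primrec_nameOf.comp (Primrec.fst.comp Primrec.fst) Primrec.snd)
  have h2 : PrimrecRel fun (_ : List (List ℕ) × ℕ) (a : ℕ) => a ≠ 0 :=
    (Primrec.eq.comp Primrec.snd (Primrec.const 0)).not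
  exact (primrecPred_forall_lt h1 (Primrec.list_length.comp (Primrec.fst.comp hd))).and
    (primrecPred_exists_mem h2 (Primrec.snd.comp hd))

/-! ### The self-referential tree -/

/-- The sequence with index `j` among the sequences encoded by `w`. -/
def component (w : Baire) (j : ℕ) : Baire := fun i => w (Nat.pair j i)

/-- The prefix of length `m` of the sequence with index `j` encoded by the finite sequence `l`. -/
def listComponent (l : List ℕ) (j m : ℕ) : List ℕ :=
  (List.range m).map fun i => l.getD (Nat.pair j i) 0

theorem getD_pair_prefixOf {w : Baire} {j i k : ℕ} (h : Nat.pair j i < k) :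
    (prefixOf w k).getD (Nat.pair j i) 0 = component w j i := getD_prefixOf h

theorem listComponent_prefixOf {w : Baire} {j m k : ℕ} (h : Nat.pair j m < k) :
    listComponent (prefixOf w k) j m = prefixOf (component w j) m := by
  rw [listComponent, prefixOf_eq_map (component w j)]
  refine List.map_congr_left fun i hi => ?_
  exact getD_prefixOf ((Nat.pair_lt_pair_right j (List.mem_range.1 hi)).trans h)

/-- The finite sequence `l` does not refute that the sequences `x, p, q, f, z, g₀, g₁, …` which it
encodes satisfy the following conditions: `f` witnesses that `p 0` satisfies the `Σ¹₁` condition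
given by `RA`; for all `i`, `gᵢ` witnesses that `(i, q i)` satisfies the `Σ¹₁` condition given by
`Rq`; the list of pairs `q` maps `p` to `x`; and the entry with index `z 0` of `x` shows that the
empty set belongs to the open set with name `x`. -/
def Consistent (RA Rq : ℕ × List ℕ → Prop) (l : List ℕ) : Prop :=
  ((∀ m < l.length, Nat.pair 1 0 < l.length → Nat.pair 3 m < l.length →
    RA (l.getD (Nat.pair 1 0) 0, listComponent l 3 m)) ∧
  ∀ i < l.length, ∀ m < l.length, Nat.pair 2 i < l.length → Nat.pair (5 + i) m < l.length →
    Rq (Nat.pair i (l.getD (Nat.pair 2 i) 0), listComponent l (5 + i) m)) ∧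
  (∀ i < l.length, Nat.pair 2 i < l.length →
    Nat.pair 1 (Denumerable.ofNat (List ℕ × List ℕ) (l.getD (Nat.pair 2 i) 0)).1.length <
      l.length →
    Nat.pair 0 (Denumerable.ofNat (List ℕ × List ℕ) (l.getD (Nat.pair 2 i) 0)).2.length <
      l.length →
    (Denumerable.ofNat (List ℕ × List ℕ) (l.getD (Nat.pair 2 i) 0)).1 = listComponent l 1
      (Denumerable.ofNat (List ℕ × List ℕ) (l.getD (Nat.pair 2 i) 0)).1.length →
    (Denumerable.ofNat (List ℕ × List ℕ) (l.getD (Nat.pair 2 i) 0)).2 = listComponent l 0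
      (Denumerable.ofNat (List ℕ × List ℕ) (l.getD (Nat.pair 2 i) 0)).2.length) ∧
  (Nat.pair 4 0 < l.length → Nat.pair 0 (l.getD (Nat.pair 4 0) 0) < l.length →
    Accepts [] (l.getD (Nat.pair 0 (l.getD (Nat.pair 4 0) 0)) 0))

theorem forall_consistent_iff {RA Rq : ℕ × List ℕ → Prop} {w : Baire} :
    (∀ k, Consistent RA Rq (prefixOf w k)) ↔
      (∀ m, RA (component w 1 0, prefixOf (component w 3) m)) ∧
      (∀ i m, Rq (Nat.pair i (component w 2 i), prefixOf (component w (5 + i)) m)) ∧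
      (∀ i, IsPrefix (Denumerable.ofNat (List ℕ × List ℕ) (component w 2 i)).1 (component w 1) →
        IsPrefix (Denumerable.ofNat (List ℕ × List ℕ) (component w 2 i)).2 (component w 0)) ∧
      Accepts [] (component w 0 (component w 4 0)) := by
  constructor
  · intro h
    refine ⟨fun m => ?_, fun i m => ?_, fun i => ?_, ?_⟩
    · have h1 : ∀ᶠ k in atTop, m < k ∧ Nat.pair 1 0 < k ∧ Nat.pair 3 m < k := by
        simp only [eventually_and, eventually_gt_atTop, and_self]
      obtain ⟨k, h1, h2, h3⟩ := h1.exists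
      have := (h k).1.1 m (by simpa) (by simpa) (by simpa)
      rwa [listComponent_prefixOf h3, getD_prefixOf h2] at this
    · have h1 : ∀ᶠ k in atTop, i < k ∧ m < k ∧ Nat.pair 2 i < k ∧ Nat.pair (5 + i) m < k := by
        simp only [eventually_and, eventually_gt_atTop, and_self]
      obtain ⟨k, h1, h2, h3, h4⟩ := h1.exists
      have := (h k).1.2 i (by simpa) m (by simpa) (by simpa) (by simpa)
      rwa [listComponent_prefixOf h4, getD_prefixOf h3] at this
    · have h1 : ∀ᶠ k in atTop, i < k ∧ Nat.pair 2 i < k ∧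
          Nat.pair 1 (Denumerable.ofNat (List ℕ × List ℕ) (component w 2 i)).1.length < k ∧
          Nat.pair 0 (Denumerable.ofNat (List ℕ × List ℕ) (component w 2 i)).2.length < k := by
        simp only [eventually_and, eventually_gt_atTop, and_self]
      obtain ⟨k, h1, h2, h3, h4⟩ := h1.exists
      have := (h k).2.1 i (by simpa) (by simpa)
      rw [getD_pair_prefixOf h2, length_prefixOf] at this
      have := this h3 h4
      rw [listComponent_prefixOf h3, listComponent_prefixOf h4] at this
      rw [isPrefix_iff_eq_prefixOf, isPrefix_iff_eq_prefixOf]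
      exact this
    · have h1 : ∀ᶠ k in atTop, Nat.pair 4 0 < k ∧ Nat.pair 0 (component w 4 0) < k := by
        simp only [eventually_and, eventually_gt_atTop, and_self]
      obtain ⟨k, h1, h2⟩ := h1.exists
      have := (h k).2.2 (by simpa)
      rw [getD_pair_prefixOf h1, length_prefixOf] at this
      have := this h2
      rwa [getD_pair_prefixOf h2] at this
  · rintro ⟨ha, hb, hc, hd⟩ k
    refine ⟨⟨fun m _ h2 h3 => ?_, fun i _ m _ h3 h4 => ?_⟩, fun i _ h2 => ?_, fun h1 => ?_⟩ <;>
      simp only [length_prefixOf] at *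
    · rw [listComponent_prefixOf h3, getD_pair_prefixOf h2]
      exact ha m
    · rw [listComponent_prefixOf h4, getD_pair_prefixOf h3]
      exact hb i m
    · rw [getD_pair_prefixOf h2]
      intro h3 h4
      rw [listComponent_prefixOf h3, listComponent_prefixOf h4]
      have := hc i
      rw [isPrefix_iff_eq_prefixOf, isPrefix_iff_eq_prefixOf] at this
      exact this
    · rw [getD_pair_prefixOf h1]
      intro h2
      rw [getD_pair_prefixOf h2]
      exact hd

theorem primrec_listComponent :
    Primrec fun x : List ℕ × (ℕ × ℕ) => listComponent x.1 x.2.1 x.2.2 :=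
  Primrec.list_map (Primrec.list_range.comp (Primrec.snd.comp Primrec.snd))
    ((Primrec.list_getD 0).comp (Primrec.fst.comp Primrec.fst)
      (Primrec₂.natPair.comp (Primrec.fst.comp (Primrec.snd.comp Primrec.fst)) Primrec.snd)).to₂

theorem computablePred_consistent {RA Rq : ℕ × List ℕ → Prop} (hA : ComputablePred RA)
    (hq : ComputablePred Rq) : ComputablePred (Consistent RA Rq) := by
  have hlt : ∀ {α : Type} [Primcodable α] {f : α → ℕ} {g : α → List ℕ}, Primrec f → Primrec g →
      PrimrecPred fun a => f a < (g a).length :=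
    fun hf hg => Primrec.nat_lt.comp hf (Primrec.list_length.comp hg)
  have hpair : ∀ {α : Type} [Primcodable α] {f : α → ℕ} (j : ℕ), Primrec f →
      Primrec fun a => Nat.pair j (f a) :=
    fun j hf => Primrec₂.natPair.comp (Primrec.const j) hf
  have hget : ∀ {α : Type} [Primcodable α] {f : α → ℕ} {g : α → List ℕ}, Primrec f → Primrec g →
      Primrec fun a => (g a).getD (f a) 0 :=
    fun hf hg => (Primrec.list_getD 0).comp hg hf
  have hlen : Computable fun l : List ℕ => l.length := Computable.list_length
  refine computablePred_and (computablePred_and ?_ ?_) (PrimrecPred.computablePred ?_)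
  · refine computablePred_forall_lt (computablePred_imp (PrimrecPred.computablePred ?_)
      (computablePred_imp (PrimrecPred.computablePred ?_) (computablePred_comp hA
        (Primrec.to_comp ?_)))) hlen
    · exact hlt (Primrec.const _) Primrec.fst
    · exact hlt (hpair 3 Primrec.snd) Primrec.fst
    · exact (hget (Primrec.const _) Primrec.fst).pair
        (primrec_listComponent.comp (Primrec.fst.pair ((Primrec.const 3).pair Primrec.snd)))
  · have h5 : Primrec fun x : (List ℕ × ℕ) × ℕ => 5 + x.1.2 :=
      Primrec.nat_add.comp (Primrec.const 5) (Primrec.snd.comp Primrec.fst)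
    refine computablePred_forall_lt (computablePred_forall_lt (computablePred_imp
      (PrimrecPred.computablePred ?_) (computablePred_imp (PrimrecPred.computablePred ?_)
        (computablePred_comp hq (Primrec.to_comp ?_)))) (hlen.comp Computable.fst)) hlen
    · exact hlt (hpair 2 (Primrec.snd.comp Primrec.fst)) (Primrec.fst.comp Primrec.fst)
    · exact hlt (Primrec₂.natPair.comp h5 Primrec.snd) (Primrec.fst.comp Primrec.fst)
    · exact (Primrec₂.natPair.comp (Primrec.snd.comp Primrec.fst)
        (hget (hpair 2 (Primrec.snd.comp Primrec.fst)) (Primrec.fst.comp Primrec.fst))).pair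
        (primrec_listComponent.comp ((Primrec.fst.comp Primrec.fst).pair
          (h5.pair Primrec.snd)))
  · have hd : Primrec fun x : List ℕ × ℕ =>
        Denumerable.ofNat (List ℕ × List ℕ) (x.1.getD (Nat.pair 2 x.2) 0) :=
      (Primrec.ofNat _).comp (hget (hpair 2 Primrec.snd) Primrec.fst)
    have hu := Primrec.fst.comp hd
    have hv := Primrec.snd.comp hd
    have hul := Primrec.list_length.comp hu
    have hvl := Primrec.list_length.comp hv
    have h1 := Primrec.eq.comp hu (primrec_listComponent.comp
      (Primrec.fst.pair ((Primrec.const 1).pair hul)))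
    have h0 := Primrec.eq.comp hv (primrec_listComponent.comp
      (Primrec.fst.pair ((Primrec.const 0).pair hvl)))
    refine PrimrecPred.and (primrecPred_forall_lt (PrimrecPred.primrecRel (primrecPred_imp
      (hlt (hpair 2 Primrec.snd) Primrec.fst) (primrecPred_imp (hlt (hpair 1 hul) Primrec.fst)
        (primrecPred_imp (hlt (hpair 0 hvl) Primrec.fst) (primrecPred_imp h1 h0)))))
      Primrec.list_length) ?_
    have h4 : Primrec fun l : List ℕ => l.getD (Nat.pair 4 0) 0 :=
      hget (Primrec.const _) Primrec.id
    exact primrecPred_imp (hlt (Primrec.const _) Primrec.id) (primrecPred_imp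
      (hlt (hpair 0 h4) Primrec.id) (primrecRel_accepts.comp (Primrec.const [])
        (hget (hpair 0 h4) Primrec.id)))

/-- The condition for `u` to be an element of the tree, given the list `τ` of the codes of elements
of the tree: `u` is consistent, and no entry up to the length of `u` of the name `x` encoded by `u`
shows that the clopen set given by `marks k s` belongs to the open set with name `x`, for an `s`
all of whose prefixes are elements of the tree with small codes. -/
def Admissible (RA Rq : ℕ × List ℕ → Prop) (τ u : List ℕ) : Prop :=
  Consistent RA Rq u ∧ ∀ n < u.length,
    (∀ i < (Denumerable.ofNat (List ℕ) n).length + 1,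
      encode ((Denumerable.ofNat (List ℕ) n).take i) < u.length ∧
        encode ((Denumerable.ofNat (List ℕ) n).take i) ∈ τ) →
    ∀ k < u.length, ∀ j < u.length, Nat.pair 0 j < u.length →
      ¬ Accepts (marks k (Denumerable.ofNat (List ℕ) n)) (u.getD (Nat.pair 0 j) 0)

theorem computablePred_admissible {RA Rq : ℕ × List ℕ → Prop} (hA : ComputablePred RA)
    (hq : ComputablePred Rq) :
    ComputablePred fun x : List ℕ × List ℕ => Admissible RA Rq x.1 x.2 := by
  have hlen : Primrec fun x : List ℕ × List ℕ => x.2.length :=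
    Primrec.list_length.comp Primrec.snd
  have hd : Primrec fun x : (List ℕ × List ℕ) × ℕ => Denumerable.ofNat (List ℕ) x.2 :=
    (Primrec.ofNat _).comp Primrec.snd
  have he : Primrec fun x : ((List ℕ × List ℕ) × ℕ) × ℕ =>
      encode ((Denumerable.ofNat (List ℕ) x.1.2).take x.2) :=
    Primrec.encode.comp (Primrec.list_take.comp Primrec.snd (hd.comp Primrec.fst))
  have h1 := (Primrec.nat_lt.comp he (hlen.comp (Primrec.fst.comp Primrec.fst))).and
    (primrecPred_mem he (Primrec.fst.comp (Primrec.fst.comp Primrec.fst)))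
  have h2 := primrecPred_forall_lt h1.primrecRel (Primrec.succ.comp (Primrec.list_length.comp hd))
  have hp : Primrec fun x : (((List ℕ × List ℕ) × ℕ) × ℕ) × ℕ => Nat.pair 0 x.2 :=
    Primrec₂.natPair.comp (Primrec.const 0) Primrec.snd
  have hu : Primrec fun x : (((List ℕ × List ℕ) × ℕ) × ℕ) × ℕ => x.1.1.1.2 :=
    Primrec.snd.comp (Primrec.fst.comp (Primrec.fst.comp Primrec.fst))
  have h3 := primrecPred_imp (Primrec.nat_lt.comp hp (Primrec.list_length.comp hu))
    (primrecRel_accepts.comp (primrec_marks.comp (Primrec.snd.comp Primrec.fst)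
      (hd.comp (Primrec.fst.comp Primrec.fst))) ((Primrec.list_getD 0).comp hu hp)).not
  have h4 := primrecPred_forall_lt h3.primrecRel
    (hlen.comp (Primrec.fst.comp (Primrec.fst (α := (List ℕ × List ℕ) × ℕ) (β := ℕ))))
  have h5 := primrecPred_forall_lt h4.primrecRel
    (hlen.comp (Primrec.fst (α := List ℕ × List ℕ) (β := ℕ)))
  exact computablePred_and (computablePred_comp (computablePred_consistent hA hq) Computable.snd)
    (primrecPred_forall_lt (primrecPred_imp h2 h5).primrecRel hlen).computablePred

open Classical in
/-- The list of the codes less than `n` of elements of the tree. -/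
noncomputable def stage (RA Rq : ℕ × List ℕ → Prop) (n : ℕ) : List ℕ :=
  Nat.rec [] (fun m τ =>
    if Admissible RA Rq τ (Denumerable.ofNat (List ℕ) m) then m :: τ else τ) n

/-- The tree of the finite sequences that are admissible with respect to the tree itself. -/
def diagonalTree (RA Rq : ℕ × List ℕ → Prop) : Set (List ℕ) :=
  {u | Admissible RA Rq (stage RA Rq (encode u)) u}

section

variable {RA Rq : ℕ × List ℕ → Prop}

open Classical in
theorem mem_stage {m n : ℕ} :
    m ∈ stage RA Rq n ↔ m < n ∧ Denumerable.ofNat (List ℕ) m ∈ diagonalTree RA Rq := by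
  induction n with
  | zero => simp [stage]
  | succ n ih =>
    have h : Admissible RA Rq (stage RA Rq n) (Denumerable.ofNat (List ℕ) n) ↔
        Denumerable.ofNat (List ℕ) n ∈ diagonalTree RA Rq := by
      rw [diagonalTree, Set.mem_ofPred_eq, Denumerable.encode_ofNat]
    have hs : stage RA Rq (n + 1) = if Admissible RA Rq (stage RA Rq n)
        (Denumerable.ofNat (List ℕ) n) then n :: stage RA Rq n else stage RA Rq n := rfl
    rw [hs, Nat.lt_succ_iff_lt_or_eq]
    split_ifs with hn
    · rw [List.mem_cons, ih]
      constructor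
      · rintro (rfl | h')
        · exact ⟨.inr rfl, h.1 hn⟩
        · exact ⟨.inl h'.1, h'.2⟩
      · rintro ⟨h' | rfl, h''⟩
        · exact .inr ⟨h', h''⟩
        · exact .inl rfl
    · rw [ih]
      constructor
      · exact fun h' => ⟨.inl h'.1, h'.2⟩
      · rintro ⟨h' | rfl, h''⟩
        · exact ⟨h', h''⟩
        · exact absurd (h.2 h'') hn

theorem computable_stage (hA : ComputablePred RA) (hq : ComputablePred Rq) :
    Computable (stage RA Rq) := by
  classical
  have h1 : Computable fun x : ℕ × (ℕ × List ℕ) =>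
      decide (Admissible RA Rq x.2.2 (Denumerable.ofNat (List ℕ) x.2.1)) :=
    (computablePred_admissible hA hq).decide.comp ((Computable.snd.comp Computable.snd).pair
      ((Computable.ofNat _).comp (Computable.fst.comp Computable.snd)))
  have h2 : Computable₂ fun (_ : ℕ) (s : ℕ × List ℕ) =>
      if Admissible RA Rq s.2 (Denumerable.ofNat (List ℕ) s.1) then s.1 :: s.2 else s.2 :=
    (Computable.cond h1 (Computable.list_cons.comp (Computable.fst.comp Computable.snd)
      (Computable.snd.comp Computable.snd)) (Computable.snd.comp Computable.snd)).of_eq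
        fun x => by
          by_cases h : Admissible RA Rq x.2.2 (Denumerable.ofNat (List ℕ) x.2.1) <;> simp [h]
  refine (Computable.nat_rec Computable.id (Computable.const []) h2).of_eq fun n => ?_
  unfold stage
  congr!

theorem mem_diagonalTree {u : List ℕ} : u ∈ diagonalTree RA Rq ↔
    Consistent RA Rq u ∧ ∀ s : List ℕ, encode s < u.length →
      (∀ i ≤ s.length, encode (s.take i) < u.length ∧ s.take i ∈ diagonalTree RA Rq) →
      ∀ k < u.length, ∀ j < u.length, Nat.pair 0 j < u.length →
        ¬ Accepts (marks k s) (u.getD (Nat.pair 0 j) 0) := by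
  have hl := Encodable.length_le_encode u
  refine and_congr_right fun _ => ⟨fun h s hs h' => ?_, fun h n hn h' => ?_⟩
  · have := h (encode s) hs
    rw [Denumerable.ofNat_encode] at this
    refine this fun i hi => ?_
    obtain ⟨h1, h2⟩ := h' i (Nat.lt_succ_iff.1 hi)
    exact ⟨h1, mem_stage.2 ⟨h1.trans_le hl, by rwa [Denumerable.ofNat_encode]⟩⟩
  · refine h _ (by rwa [Denumerable.encode_ofNat]) fun i hi => ?_
    obtain ⟨h1, h2⟩ := h' i (Nat.lt_succ_iff.2 hi)
    refine ⟨h1, ?_⟩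
    have := (mem_stage.1 h2).2
    rwa [Denumerable.ofNat_encode] at this

/-! ### Diagonalization -/

variable {A : Set ℕ} {q : Baire} {F : Baire → Baire}

theorem not_isPath_diagonalTree (hA : ∀ n, n ∈ A ↔ ∃ f : Baire, ∀ k, RA (n, prefixOf f k))
    (hq : ∀ i v, q i = v ↔ ∃ f : Baire, ∀ k, Rq (Nat.pair i v, prefixOf f k))
    (hF : Codes q {p | p 0 ∈ A} F) (hdom : ∀ p : Baire, p 0 ∈ A → F p ∈ clopens.opens.dom)
    (α : Baire) : ¬ IsPath (diagonalTree RA Rq) α := by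
  intro hα
  obtain ⟨ha, hb, hc, hd⟩ := forall_consistent_iff.1 fun k => (mem_diagonalTree.1 (hα k)).1
  have hp : component α 1 0 ∈ A := (hA _).2 ⟨_, ha⟩
  obtain rfl : q = component α 2 := funext fun i => (hq _ _).2 ⟨_, hb i⟩
  have hx : F (component α 1) = component α 0 := by
    funext n
    obtain ⟨u, hu, i, hi⟩ := (hF _ hp).2 _ (isPrefix_prefixOf (F (component α 1)) (n + 1))
    have h1 := hc i
    rw [hi, Denumerable.ofNat_encode] at h1
    have h2 := h1 hu n (by simp)
    simpa [prefixOf, -List.ofFn_succ] using h2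
  obtain ⟨V, hV⟩ := hx ▸ hdom _ hp
  have h0 : V.1 emptyClopen := (exists_accepts_iff hV (exists_clopen []).choose_spec.1).1 ⟨_, hd⟩
  obtain ⟨k, m, hkm⟩ := exists_marks_mem V h0 α
  obtain ⟨f, hf, -⟩ := exists_clopen (marks k (prefixOf α m))
  obtain ⟨j, hj⟩ := (exists_accepts_iff hV hf).2 (hkm f hf)
  have h1 : ∀ᶠ t in atTop, (∀ i ∈ Finset.range (m + 1), encode (prefixOf α i) < t) ∧
      k < t ∧ j < t ∧ Nat.pair 0 j < t := by
    rw [eventually_and, Filter.eventually_all_finset]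
    exact ⟨fun i _ => eventually_gt_atTop _, by
      simp only [eventually_and, eventually_gt_atTop, and_self]⟩
  obtain ⟨t, h1, h2, h3, h4⟩ := h1.exists
  have h5 := (mem_diagonalTree.1 (hα t)).2 (prefixOf α m) (by simpa using h1 m (by simp))
    (fun i hi => ?_) k (by simpa) j (by simpa) (by simpa)
  · rw [getD_prefixOf h4] at h5
    exact h5 hj
  · rw [length_prefixOf] at hi
    rw [take_prefixOf α hi, length_prefixOf]
    exact ⟨h1 i (by simpa using Nat.lt_succ_iff.2 hi), hα i⟩

theorem not_subset_treeSet_diagonalTree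
    (hA : ∀ n, n ∈ A ↔ ∃ f : Baire, ∀ k, RA (n, prefixOf f k))
    (hq : ∀ i v, q i = v ↔ ∃ f : Baire, ∀ k, Rq (Nat.pair i v, prefixOf f k))
    (hF : Codes q {p | p 0 ∈ A} F) (hT : ∀ α, ¬ IsPath (diagonalTree RA Rq) α)
    {p : Baire} (hp : p 0 ∈ A) {V : clopens.opens.carrier} (hV : clopens.opens.Names (F p) V)
    (h0 : V.1 emptyClopen) : ¬ ∀ f, V.1 f → treeSet (diagonalTree RA Rq) f := by
  intro hsub
  obtain ⟨f, hf⟩ := (hA _).1 hp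
  choose g hg using fun i => (hq i _).1 rfl
  obtain ⟨z, hz⟩ := (exists_accepts_iff hV (exists_clopen []).choose_spec.1).2 h0
  let c : ℕ → Baire
    | 0 => F p
    | 1 => p
    | 2 => q
    | 3 => f
    | 4 => fun _ => z
    | i + 5 => g i
  let w : Baire := fun n => c n.unpair.1 n.unpair.2
  have hw : ∀ j, component w j = c j := fun j => funext fun i => by simp [component, w]
  have hcons : ∀ k, Consistent RA Rq (prefixOf w k) := by
    refine forall_consistent_iff.2 ⟨?_, fun i => ?_, fun i => ?_, ?_⟩
    · simp only [hw]
      exact hf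
    · simp only [hw, add_comm 5 i]
      exact hg i
    · simp only [hw]
      exact (hF p hp).1 _ _ ⟨i, (Denumerable.encode_ofNat (α := List ℕ × List ℕ) (q i)).symm⟩
    · simp only [hw]
      exact hz
  refine hT w fun t => mem_diagonalTree.2 ⟨hcons t, fun s _ hs k _ j _ hj hacc => ?_⟩
  rw [getD_prefixOf (by simpa using hj)] at hacc
  obtain ⟨f', hf', -⟩ := exists_clopen (marks k s)
  have hx : w (Nat.pair 0 j) = F p j := by simp [w, c]
  refine not_treeSet_of_marks (fun i => ?_) hf'
    (hsub f' ((exists_accepts_iff hV hf').1 ⟨j, hx ▸ hacc⟩))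
  obtain hi | hi := le_total i s.length
  · exact (hs i hi).2
  · rw [List.take_of_length_le hi, ← List.take_length (l := s)]
    exact (hs _ le_rfl).2

/-- For every family of open sets of clopen sets indexed by the points `p` with `p 0 ∈ A`
there is an open neighbourhood of the empty set that includes no member of the family that is a
neighbourhood of the empty set. It is computable if `A` and the graph of the list `q` of pairs
describing the family are `Σ¹₁`. -/
theorem exists_open_not_superset (hA : ∀ n, n ∈ A ↔ ∃ f : Baire, ∀ k, RA (n, prefixOf f k))
    (hq : ∀ i v, q i = v ↔ ∃ f : Baire, ∀ k, Rq (Nat.pair i v, prefixOf f k))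
    (hF : Codes q {p | p 0 ∈ A} F) (hdom : ∀ p : Baire, p 0 ∈ A → F p ∈ clopens.opens.dom) :
    ∃ U : clopens.opens.carrier, U.1 emptyClopen ∧
      (ComputablePred RA → ComputablePred Rq → U ∈ clopens.opens.computablePoints) ∧
      ∀ p : Baire, p 0 ∈ A → ∀ V, clopens.opens.Names (F p) V → V.1 emptyClopen →
        ¬ ∀ f, V.1 f → U.1 f := by
  have hT := not_isPath_diagonalTree hA hq hF hdom
  obtain ⟨U, hU, hc⟩ := exists_open_treeSet (fun m n => mem_stage (m := m) (n := n)) hT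
  refine ⟨U, by rw [hU]; exact treeSet_emptyClopen hT, fun h1 h2 => hc (computable_stage h1 h2),
    fun p hp V hV h0 => ?_⟩
  rw [hU]
  exact not_subset_treeSet_diagonalTree hA hq hF hT hp hV h0

end

/-! ### Predicates in the class `Σ¹₁` -/

/-- The predicate `P` is (lightface) `Σ¹₁`; the witnesses are points of the Baire space. -/
def IsSigma11 {α : Type*} [Primcodable α] (P : α → Prop) : Prop :=
  ∃ R : α × List ℕ → Prop, ComputablePred R ∧ ∀ a, P a ↔ ∃ f : Baire, ∀ k, R (a, prefixOf f k)

namespace IsSigma11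

section

variable {α β : Type} [Primcodable α] [Primcodable β] {P Q : α → Prop}

theorem of_iff (hP : IsSigma11 P) (h : ∀ a, P a ↔ Q a) : IsSigma11 Q :=
  (funext fun a => propext (h a) : P = Q) ▸ hP

theorem of_computable (hP : ComputablePred P) : IsSigma11 P :=
  ⟨fun x => P x.1, computablePred_comp hP Computable.fst, fun _ =>
    ⟨fun h => ⟨fun _ => 0, fun _ => h⟩, fun ⟨_, h⟩ => h 0⟩⟩

theorem comp {P : β → Prop} (hP : IsSigma11 P) {f : α → β} (hf : Computable f) :
    IsSigma11 fun a => P (f a) := by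
  obtain ⟨R, hR, h⟩ := hP
  exact ⟨fun x => R (f x.1, x.2), computablePred_comp hR
    ((hf.comp Computable.fst).pair Computable.snd), fun a => h (f a)⟩

theorem imp (hP : ComputablePred P) (hQ : IsSigma11 Q) : IsSigma11 fun a => P a → Q a := by
  obtain ⟨R, hR, h⟩ := hQ
  refine ⟨fun x => P x.1 → R x, computablePred_imp (computablePred_comp hP Computable.fst) hR,
    fun a => ?_⟩
  simp only [h]
  by_cases ha : P a <;> simp [ha]

theorem all {P : α → ℕ → Prop} (hP : IsSigma11 fun x : α × ℕ => P x.1 x.2) :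
    IsSigma11 fun a => ∀ n, P a n := by
  obtain ⟨R, hR, h⟩ := hP
  refine ⟨fun x => ∀ n < x.2.length, ∀ m < x.2.length, Nat.pair n m < x.2.length →
    R ((x.1, n), listComponent x.2 n m), ?_, fun a => ⟨fun ha => ?_, ?_⟩⟩
  · have hl : Primrec fun x : ((α × List ℕ) × ℕ) × ℕ => x.1.1.2 :=
      Primrec.snd.comp (Primrec.fst.comp Primrec.fst)
    have hn : Primrec fun x : ((α × List ℕ) × ℕ) × ℕ => x.1.2 :=
      Primrec.snd.comp Primrec.fst
    have hlen : Computable fun x : α × List ℕ => x.2.length :=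
      Computable.list_length.comp Computable.snd
    refine computablePred_forall_lt (computablePred_forall_lt (computablePred_imp
      (PrimrecPred.computablePred ?_) (computablePred_comp hR (Primrec.to_comp ?_)))
      (hlen.comp Computable.fst)) hlen
    · exact Primrec.nat_lt.comp (Primrec₂.natPair.comp hn Primrec.snd)
        (Primrec.list_length.comp hl)
    · exact ((Primrec.fst.comp (Primrec.fst.comp Primrec.fst)).pair hn).pair
        (primrec_listComponent.comp (hl.pair (hn.pair Primrec.snd)))
  · choose g hg using fun n => (h (a, n)).1 (ha n)
    refine ⟨fun i => g i.unpair.1 i.unpair.2, fun k n _ m _ hk => ?_⟩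
    rw [length_prefixOf] at hk
    have : component (fun i => g i.unpair.1 i.unpair.2) n = g n := by
      funext i
      simp [component]
    rw [listComponent_prefixOf hk, this]
    exact hg n m
  · rintro ⟨f, hf⟩ n
    refine (h (a, n)).2 ⟨component f n, fun m => ?_⟩
    have h1 : ∀ᶠ k in atTop, n < k ∧ m < k ∧ Nat.pair n m < k := by
      simp only [eventually_and, eventually_gt_atTop, and_self]
    obtain ⟨k, h1, h2, h3⟩ := h1.exists
    have := hf k n (by simpa) m (by simpa) (by simpa)
    rwa [listComponent_prefixOf h3] at this

theorem and (hP : IsSigma11 P) (hQ : IsSigma11 Q) : IsSigma11 fun a => P a ∧ Q a := by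
  have h0 : ComputablePred fun x : α × ℕ => x.2 = 0 :=
    (Primrec.eq.comp Primrec.snd (Primrec.const 0)).computablePred
  obtain ⟨R, hR, h⟩ := hP.comp (f := fun x : α × ℕ => x.1) Computable.fst
  obtain ⟨R', hR', h'⟩ := hQ.comp (f := fun x : α × ℕ => x.1) Computable.fst
  have key : IsSigma11 fun x : α × ℕ => (x.2 = 0 → P x.1) ∧ (¬ x.2 = 0 → Q x.1) := by
    refine ⟨fun y => (y.1.2 = 0 → R y) ∧ (¬ y.1.2 = 0 → R' y), computablePred_and
      (computablePred_imp (computablePred_comp h0 Computable.fst) hR)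
      (computablePred_imp (computablePred_comp (p := fun x : α × ℕ => ¬ x.2 = 0) h0.not
        Computable.fst) hR'), fun x => ?_⟩
    beta_reduce at h h'
    simp only [h, h']
    by_cases hx : x.2 = 0 <;> simp [hx]
  exact (all (P := fun a n => (n = 0 → P a) ∧ (¬ n = 0 → Q a)) key).of_iff fun a =>
    ⟨fun hx => ⟨(hx 0).1 rfl, (hx 1).2 one_ne_zero⟩, fun hx n => ⟨fun _ => hx.1, fun _ => hx.2⟩⟩

theorem ex {P : α → ℕ → Prop} (hP : IsSigma11 fun x : α × ℕ => P x.1 x.2) :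
    IsSigma11 fun a => ∃ n, P a n := by
  obtain ⟨R, hR, h⟩ := hP
  -- a witness encodes a pair of sequences, the first of which starts with the number
  refine ⟨fun x => ∀ m < x.2.length, Nat.pair 0 0 < x.2.length → Nat.pair 1 m < x.2.length →
    R ((x.1, x.2.getD (Nat.pair 0 0) 0), listComponent x.2 1 m), ?_, fun a => ⟨?_, ?_⟩⟩
  · have hl : Primrec fun x : (α × List ℕ) × ℕ => x.1.2 := Primrec.snd.comp Primrec.fst
    refine computablePred_forall_lt (computablePred_imp (PrimrecPred.computablePred ?_)
      (computablePred_imp (PrimrecPred.computablePred ?_) (computablePred_comp hR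
        (Primrec.to_comp ?_)))) (Computable.list_length.comp Computable.snd)
    · exact Primrec.nat_lt.comp (Primrec.const _) (Primrec.list_length.comp hl)
    · exact Primrec.nat_lt.comp (Primrec₂.natPair.comp (Primrec.const 1) Primrec.snd)
        (Primrec.list_length.comp hl)
    · exact ((Primrec.fst.comp Primrec.fst).pair ((Primrec.list_getD 0).comp hl
        (Primrec.const _))).pair
        (primrec_listComponent.comp (hl.pair ((Primrec.const 1).pair Primrec.snd)))
  · rintro ⟨n, hn⟩
    obtain ⟨g, hg⟩ := (h (a, n)).1 hn
    let w : Baire := fun i => if i.unpair.1 = 0 then n else g i.unpair.2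
    have hw : component w 1 = g := by
      funext i
      simp [component, w]
    refine ⟨w, fun k m _ h1 h2 => ?_⟩
    rw [length_prefixOf] at h1 h2
    rw [listComponent_prefixOf h2, getD_pair_prefixOf h1, hw]
    exact hg m
  · rintro ⟨f, hf⟩
    refine ⟨component f 0 0, (h (a, _)).2 ⟨component f 1, fun m => ?_⟩⟩
    have h1 : ∀ᶠ k in atTop, m < k ∧ Nat.pair 0 0 < k ∧ Nat.pair 1 m < k := by
      simp only [eventually_and, eventually_gt_atTop, and_self]
    obtain ⟨k, h1, h2, h3⟩ := h1.exists
    have := hf k m (by simpa) (by simpa) (by simpa)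
    rwa [listComponent_prefixOf h3, getD_pair_prefixOf h2] at this

end

end IsSigma11

/-! ### Functions that are computable relative to a `Δ¹₁` set -/

/-- The graph of the partial function `f` is `Σ¹₁`. -/
def GraphSigma11 (f : ℕ →. ℕ) : Prop := IsSigma11 fun x : ℕ × ℕ => x.2 ∈ f x.1

theorem graphSigma11_of_primrec {f : ℕ → ℕ} (hf : Primrec f) :
    GraphSigma11 fun n => Part.some (f n) :=
  (IsSigma11.of_computable (Primrec.eq.comp Primrec.snd
    (hf.comp Primrec.fst)).computablePred).of_iff fun _ => Part.mem_some_iff.symm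

theorem graphSigma11_charFun {A : Set ℕ} (hA : A ∈ delta11) :
    GraphSigma11 (charFun A : ℕ →. ℕ) := by
  have h1 : IsSigma11 fun n => n ∈ A := hA.1
  have h2 : IsSigma11 fun n => n ∈ Aᶜ := hA.2
  have e : ∀ c : ℕ, ComputablePred fun x : ℕ × ℕ => x.2 = c := fun c =>
    (Primrec.eq.comp Primrec.snd (Primrec.const c)).computablePred
  have h3 := (h1.comp (f := fun x : ℕ × ℕ => x.1) Computable.fst).imp (e 1)
  have h4 := ((h2.comp (f := fun x : ℕ × ℕ => x.1) Computable.fst).and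
    (.of_computable (e 0))).imp (e 1).not
  refine (h3.and h4).of_iff fun x => ?_
  rw [PFun.coe_val, Part.mem_some_iff, charFun]
  by_cases hx : x.1 ∈ A
  · simp [hx]
  · simp only [hx, Set.mem_compl_iff, not_false_eq_true, true_and,
      Set.indicator_of_notMem, imp_false]
    exact ⟨fun h => h.2 h.1, fun h => by simp [h]⟩

theorem mem_rec_iff {f : Part ℕ} {h : ℕ → ℕ →. ℕ} {n v : ℕ} :
    v ∈ (Nat.rec f (fun y IH => IH.bind (h y)) n : Part ℕ) ↔
      ∃ c : ℕ, ((Denumerable.ofNat (List ℕ) c).getD 0 0 ∈ f ∧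
        ∀ i, i < n → (Denumerable.ofNat (List ℕ) c).getD (i + 1) 0 ∈
          h i ((Denumerable.ofNat (List ℕ) c).getD i 0)) ∧
        v = (Denumerable.ofNat (List ℕ) c).getD n 0 := by
  constructor
  · intro hv
    suffices ∃ g : ℕ → ℕ, (g 0 ∈ f ∧ ∀ i, i < n → g (i + 1) ∈ h i (g i)) ∧ v = g n by
      obtain ⟨g, ⟨h0, h1⟩, h2⟩ := this
      have hg : ∀ i ≤ n, (Denumerable.ofNat (List ℕ) (encode (prefixOf g (n + 1)))).getD i 0 =
          g i := fun i hi => by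
        rw [Denumerable.ofNat_encode, getD_prefixOf (Nat.lt_succ_of_le hi)]
      refine ⟨encode (prefixOf g (n + 1)), ⟨by rwa [hg 0 (Nat.zero_le n)], fun i hi => ?_⟩, ?_⟩
      · rw [hg _ hi, hg _ hi.le]
        exact h1 i hi
      · rwa [hg n le_rfl]
    induction n generalizing v with
    | zero => exact ⟨fun _ => v, ⟨hv, by simp⟩, rfl⟩
    | succ n ih =>
      obtain ⟨b, hb, hvb⟩ := Part.mem_bind_iff.1 hv
      obtain ⟨g, ⟨h0, h1⟩, rfl⟩ := ih hb
      refine ⟨Function.update g (n + 1) v, ⟨?_, fun i hi => ?_⟩, by simp⟩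
      · rwa [Function.update_of_ne (by simp)]
      · obtain hi | rfl := Nat.lt_succ_iff_lt_or_eq.1 hi
        · rw [Function.update_of_ne (by omega), Function.update_of_ne (by omega)]
          exact h1 i hi
        · rw [Function.update_self, Function.update_of_ne (by simp)]
          exact hvb
  · rintro ⟨c, ⟨h0, h1⟩, rfl⟩
    suffices ∀ m ≤ n, (Denumerable.ofNat (List ℕ) c).getD m 0 ∈
        (Nat.rec f (fun y IH => IH.bind (h y)) m : Part ℕ) from this n le_rfl
    intro m
    induction m with
    | zero => exact fun _ => h0
    | succ m ih => exact fun hm => Part.mem_bind_iff.2 ⟨_, ih (by omega), h1 m hm⟩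

/-- The `Σ¹₁` class is closed under the operations that generate the functions recursive in an
oracle. -/
theorem graphSigma11_of_recursiveIn {O : Set (ℕ →. ℕ)} (hO : ∀ g ∈ O, GraphSigma11 g)
    {f : ℕ →. ℕ} (hf : Nat.RecursiveIn O f) : GraphSigma11 f := by
  induction hf with
  | zero => exact graphSigma11_of_primrec (Primrec.const 0)
  | succ => exact graphSigma11_of_primrec Primrec.succ
  | left => exact graphSigma11_of_primrec (Primrec.fst.comp Primrec.unpair)
  | right => exact graphSigma11_of_primrec (Primrec.snd.comp Primrec.unpair)
  | oracle g hg => exact hO g hg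
  | pair _ _ ihf ihh =>
    have hv : Primrec fun x : ℕ × ℕ => x.2.unpair := Primrec.unpair.comp Primrec.snd
    refine ((ihf.comp (f := fun x : ℕ × ℕ => (x.1, x.2.unpair.1))
      (Primrec.fst.pair (Primrec.fst.comp hv)).to_comp).and
      (ihh.comp (f := fun x : ℕ × ℕ => (x.1, x.2.unpair.2))
        (Primrec.fst.pair (Primrec.snd.comp hv)).to_comp)).of_iff fun x => ?_
    simp only [Seq.seq, Part.map_eq_map, Part.bind_map, Part.mem_bind_iff, Part.mem_map_iff]
    constructor
    · exact fun h => ⟨_, h.1, _, h.2, by simp⟩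
    · rintro ⟨a, ha, b, hb, hx⟩
      simp [← hx, ha, hb]
  | @comp f h _ _ ihf ihh =>
    refine (IsSigma11.ex (P := fun (x : ℕ × ℕ) b => b ∈ h x.1 ∧ x.2 ∈ f b) ((ihh.comp
      (f := fun y : (ℕ × ℕ) × ℕ => (y.1.1, y.2))
      ((Primrec.fst.comp Primrec.fst).pair Primrec.snd).to_comp).and
      (ihf.comp (f := fun y : (ℕ × ℕ) × ℕ => (y.2, y.1.2))
        (Primrec.snd.pair (Primrec.snd.comp Primrec.fst)).to_comp))).of_iff fun x => ?_
    exact Part.mem_bind_iff.symm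
  | @prec f h _ _ ihf ihh =>
    have ha : Primrec fun x : ℕ × ℕ => x.1.unpair.1 :=
      Primrec.fst.comp (Primrec.unpair.comp Primrec.fst)
    have hn : Primrec fun x : ℕ × ℕ => x.1.unpair.2 :=
      Primrec.snd.comp (Primrec.unpair.comp Primrec.fst)
    have hget : ∀ {α : Type} [Primcodable α] {c i : α → ℕ}, Primrec c → Primrec i →
        Primrec fun y => (Denumerable.ofNat (List ℕ) (c y)).getD (i y) 0 :=
      fun hc hi => (Primrec.list_getD 0).comp ((Primrec.ofNat _).comp hc) hi
    have h1 := ihf.comp (f := fun y : (ℕ × ℕ) × ℕ =>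
      (y.1.1.unpair.1, (Denumerable.ofNat (List ℕ) y.2).getD 0 0))
      ((ha.comp Primrec.fst).pair (hget Primrec.snd (Primrec.const 0))).to_comp
    have h2 := ihh.comp (f := fun z : ((ℕ × ℕ) × ℕ) × ℕ =>
      (Nat.pair z.1.1.1.unpair.1 (Nat.pair z.2 ((Denumerable.ofNat (List ℕ) z.1.2).getD z.2 0)),
        (Denumerable.ofNat (List ℕ) z.1.2).getD (z.2 + 1) 0))
      ((Primrec₂.natPair.comp (ha.comp (Primrec.fst.comp Primrec.fst)) (Primrec₂.natPair.comp
        Primrec.snd (hget (Primrec.snd.comp Primrec.fst) Primrec.snd))).pair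
        (hget (Primrec.snd.comp Primrec.fst) (Primrec.succ.comp Primrec.snd))).to_comp
    have h3 := IsSigma11.all (P := fun (y : (ℕ × ℕ) × ℕ) i => i < y.1.1.unpair.2 →
      (Denumerable.ofNat (List ℕ) y.2).getD (i + 1) 0 ∈ h (Nat.pair y.1.1.unpair.1
        (Nat.pair i ((Denumerable.ofNat (List ℕ) y.2).getD i 0)))) (h2.imp (Primrec.nat_lt.comp
          Primrec.snd (hn.comp (Primrec.fst.comp Primrec.fst))).computablePred)
    have h4 : ComputablePred fun y : (ℕ × ℕ) × ℕ =>
        y.1.2 = (Denumerable.ofNat (List ℕ) y.2).getD y.1.1.unpair.2 0 :=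
      (Primrec.eq.comp (Primrec.snd.comp Primrec.fst)
        (hget Primrec.snd (hn.comp Primrec.fst))).computablePred
    refine (IsSigma11.ex (P := fun (x : ℕ × ℕ) c =>
      ((Denumerable.ofNat (List ℕ) c).getD 0 0 ∈ f x.1.unpair.1 ∧
        ∀ i, i < x.1.unpair.2 → (Denumerable.ofNat (List ℕ) c).getD (i + 1) 0 ∈
          h (Nat.pair x.1.unpair.1
            (Nat.pair i ((Denumerable.ofNat (List ℕ) c).getD i 0)))) ∧
        x.2 = (Denumerable.ofNat (List ℕ) c).getD x.1.unpair.2 0)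
      ((h1.and h3).and (.of_computable h4))).of_iff fun x => ?_
    exact (mem_rec_iff (f := f x.1.unpair.1)
      (h := fun y i => h (Nat.pair x.1.unpair.1 (Nat.pair y i)))).symm
  | @rfind f _ ih =>
    have h1 := ih.comp (f := fun x : ℕ × ℕ => (Nat.pair x.1 x.2, 0))
      (Primrec.pair Primrec₂.natPair (Primrec.const 0)).to_comp
    have h2 := IsSigma11.ex (P := fun (y : (ℕ × ℕ) × ℕ) b => b ∈ f (Nat.pair y.1.1 y.2) ∧ ¬ b = 0)
      ((ih.comp (f := fun z : ((ℕ × ℕ) × ℕ) × ℕ => (Nat.pair z.1.1.1 z.1.2, z.2))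
      ((Primrec₂.natPair.comp (Primrec.fst.comp (Primrec.fst.comp Primrec.fst))
        (Primrec.snd.comp Primrec.fst)).pair Primrec.snd).to_comp).and (.of_computable
          (Primrec.eq.comp Primrec.snd (Primrec.const 0)).not.computablePred))
    have h3 := IsSigma11.all (P := fun (x : ℕ × ℕ) m => m < x.2 →
      ∃ b, b ∈ f (Nat.pair x.1 m) ∧ ¬ b = 0) (h2.imp
      (Primrec.nat_lt.comp Primrec.snd (Primrec.snd.comp Primrec.fst)).computablePred)
    refine (h1.and h3).of_iff fun x => ?_
    refine Iff.trans ?_ Nat.mem_rfind.symm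
    simp [Part.mem_map_iff]

theorem isSigma11_of_computableIn {A : Set ℕ} (hA : A ∈ delta11) {q : Baire}
    (hq : ComputableIn {(charFun A : ℕ →. ℕ)} q) : IsSigma11 fun x : ℕ × ℕ => q x.1 = x.2 := by
  refine IsSigma11.of_iff (graphSigma11_of_recursiveIn ?_ (RecursiveIn.iff_nat.1 hq)) fun x => ?_
  · rintro g rfl
    exact graphSigma11_charFun hA
  · exact Part.mem_some_iff.trans eq_comm

/-! ### Consequences for families of open sets -/

theorem isOpen_toSet {X : RepresentedSpace} (U : X.opens.carrier) :
    IsOpen[X.topology] (toSet U) := by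
  obtain ⟨F, hFc, hF⟩ := U.2
  refine isOpen_coinduced.2 ?_
  have : X.rep ⁻¹' toSet U = (fun p : X.dom => F p) ⁻¹' {fun _ => 0}ᶜ := by
    ext p
    exact (hF p (X.rep p) p.2.choose_spec).symm
  rw [this]
  exact isOpen_compl_singleton.preimage hFc.domRestrict

/-- No continuous family of open sets indexed by the Baire space contains, for every open
neighbourhood of the empty set, a neighbourhood of the empty set included in it. -/
theorem exists_open_not_superset_of_isContinuous {f : Baire → clopens.opens.carrier}
    (hf : IsContinuous baire clopens.opens f) :
    ∃ U : clopens.opens.carrier, U.1 emptyClopen ∧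
      ∀ p, (f p).1 emptyClopen → ¬ ∀ x, (f p).1 x → U.1 x := by
  obtain ⟨F, hFc, hF⟩ := hf
  obtain ⟨q, hq⟩ := exists_codes hFc
  obtain ⟨U, h0, -, hU⟩ := exists_open_not_superset (A := Set.univ) (q := q) (F := F)
    (RA := fun _ => True) (Rq := fun x => q x.1.unpair.1 = x.1.unpair.2) (by simp) (by simp)
    (fun p _ => hq p ⟨p, rfl⟩) fun p _ => ⟨_, hF p p rfl⟩
  exact ⟨U, h0, fun p => hU p trivial _ (hF p p rfl)⟩

/-- A `Σ¹₁`-indexed family of open sets, described by a list of pairs with `Σ¹₁` graph, misses some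
computable open set. -/
theorem exists_computable_open_notMem {A : Set ℕ} (hA : A ∈ sigma11) {q : Baire}
    (hq : IsSigma11 fun x : ℕ × ℕ => q x.1 = x.2) {F : Baire → Baire}
    (hF : Codes q {p | p 0 ∈ A} F) (hdom : ∀ p : Baire, p 0 ∈ A → F p ∈ clopens.opens.dom) :
    ∃ U ∈ clopens.opens.computablePoints,
      ∀ p : Baire, p 0 ∈ A → ¬ clopens.opens.Names (F p) U := by
  obtain ⟨RA, hRA, hA⟩ := hA
  obtain ⟨Rq, hRq, hq⟩ := hq.comp (f := Nat.unpair) Computable.unpair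
  obtain ⟨U, h0, hc, hU⟩ := exists_open_not_superset hA
    (fun i v => by simpa using hq (Nat.pair i v)) hF hdom
  exact ⟨U, hc hRA hRq, fun p hp hn => hU p hp U hn h0 fun _ h => h⟩

end BaireClopens

theorem mainTheorem5 :
    ¬ RepresentedSpace.clopens.IsBaireBased ∧
    ¬ RepresentedSpace.IsContinuousImage RepresentedSpace.baire
        RepresentedSpace.clopens.opens ∧
    ¬ RepresentedSpace.ComputablePointsEnumerable sigma11 RepresentedSpace.clopens.opens ∧
    ∀ A ∈ delta11,
      ¬ RepresentedSpace.ComputablePointsEnumerableRel A RepresentedSpace.clopens.opens := by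
  refine ⟨?_, ?_, ?_, ?_⟩
  · rintro ⟨f, hf, hb⟩
    obtain ⟨U, h0, hU⟩ := BaireClopens.exists_open_not_superset_of_isContinuous hf
    obtain ⟨_, ⟨p, rfl⟩, hp, hsub⟩ := @TopologicalSpace.IsTopologicalBasis.exists_subset_of_mem_open
      _ (_) _ hb _ _ (show BaireClopens.emptyClopen ∈ RepresentedSpace.toSet U from h0)
      (BaireClopens.isOpen_toSet U)
    exact hU p hp fun _ h => hsub h
  · rintro ⟨f, hf, hs⟩
    obtain ⟨U, h0, hU⟩ := BaireClopens.exists_open_not_superset_of_isContinuous hf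
    obtain ⟨p, rfl⟩ := hs U
    exact hU p h0 fun _ h => h
  · rintro ⟨A, hA, f, ⟨F, ⟨q, hq, hF⟩, hr⟩, hs⟩
    have hr' : ∀ (p : Baire) (hp : p 0 ∈ A),
        RepresentedSpace.clopens.opens.Names (F p) (f ⟨p 0, hp⟩).1 := fun p hp =>
      hr p ⟨p 0, hp⟩ rfl
    obtain ⟨U, hU, h⟩ := BaireClopens.exists_computable_open_notMem hA
      (.of_computable ⟨inferInstance,
        Primrec.beq.to_comp.comp (hq.comp Computable.fst) Computable.snd⟩)
      (fun p hp => hF p ⟨⟨p 0, hp⟩, rfl⟩)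
      fun p hp => ⟨_, hr' p hp⟩
    obtain ⟨n, hn⟩ := hs ⟨U, hU⟩
    refine h (fun _ => n.1) n.2 ?_
    have := hr' (fun _ => n.1) n.2
    rwa [show f ⟨n.1, n.2⟩ = ⟨U, hU⟩ from hn] at this
  · rintro A hA ⟨f, ⟨F, ⟨q, hq, hF⟩, hr⟩, hs⟩
    have hr' : ∀ p : Baire, RepresentedSpace.clopens.opens.Names (F p) (f (p 0)) := fun p =>
      hr p (p 0) rfl
    obtain ⟨U, hU, h⟩ := BaireClopens.exists_computable_open_notMem (A := Set.univ)
      (BaireClopens.IsSigma11.of_computable (P := fun n : ℕ => n ∈ Set.univ)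
        ((Primrec.eq.comp Primrec.id Primrec.id).of_eq (by simp)).computablePred)
      (BaireClopens.isSigma11_of_computableIn hA hq) (fun p _ => hF p ⟨p 0, rfl⟩)
      fun p _ => ⟨_, hr' p⟩
    obtain ⟨n, rfl⟩ := hs hU
    exact h (fun _ => n) trivial (hr' fun _ => n)
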